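/- Let $k$ be a field and $H$ a cocommutative Hopf algebra over $k$; write $\otimes=\otimes_k$ and let $\Delta,\varepsilon$ be the comultiplication and counit of $H$. A right $H$-comodule algebra is a (possibly noncommutative) unital $k$-algebra $A$ with a coassociative, counital right $H$-coaction $\rho: A\to A\otimes H$, $\rho(a)=a_{[0]}\otimes a_{[1]}$, that is a $k$-algebra morphism; its subalgebra of coinvariants is $A^{\mathrm{co}H}=\{a\in A:\rho(a)=a\otimes 1\}$. We say that $A$ is a faithfully flat $H$-Galois extension of $B=A^{\mathrm{co}H}$ if the canonical map $\mathrm{can}: A\otimes_B A\to A\otimes H$, $a\otimes_B a'\mapsto a\,a'_{[0]}\otimes a'_{[1]}$, is bijective and $A$ is faithfully flat as a left $B$-module, i.e. the functor $-\otimes_B A$ on right $B$-modules preserves and reflects exact sequences. Let $A$ and $A'$ be right $H$-comodule algebras which are faithfully flat $H$-Galois extensions of $B=A^{\mathrm{co}H}$ and $B'=A'^{\mathrm{co}H}$. Consider the cotensor product $$A\square_H A'=\Big\{\sum_i a_i\otimes a'_i\in A\otimes A' : \sum_i a_{i[0]}\otimes a'_i\otimes a_{i[1]}=\sum_i a_i\otimes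 a'_{i[0]}\otimes a'_{i[1]}\Big\},$$ a subalgebra of $A\otimes A'$ and a right $H$-comodule algebra with coaction $$\rho\Big(\sum_i a_i\otimes a'_i\Big)=\sum_i a_{i[0]}\otimes a'_i\otimes a_{i[1]}=\sum_i a_i\otimes a'_{i[0]}\otimes a'_{i[1]}.$$ Then $A\square_H A'$ is a faithfully flat $H$-Galois extension of $B\otimes B'$; that is, $A\square_H A'$ is a faithfully flat $H$-Galois extension of $(A\square_H A')^{\mathrm{co}H}$, and the canonical map $b\otimes b'\mapsto b\otimes b'$ is an isomorphism of algebras $B\otimes B'\cong(A\square_H A')^{\mathrm{co}H}$. -/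

import Mathlib

open scoped TensorProduct

universe u v w

noncomputable section

namespace HopfGalois

/-- A right `H`-comodule algebra structure on a `k`-algebra `A`: a coassociative and counital
right coaction `A → A ⊗ H` which is a morphism of `k`-algebras. -/
class RightComoduleAlgebra (k : Type*) (H : Type*) (A : Type*) [CommRing k] [Ring H]
    [Bialgebra k H] [Ring A] [Algebra k A] where
  /-- The coaction `ρ : A → A ⊗ H`, `ρ a = a₀ ⊗ a₁`. -/
  coact : A →ₐ[k] A ⊗[k] H
  /-- `(ρ ⊗ id) ∘ ρ = (id ⊗ Δ) ∘ ρ`. -/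
  coassoc : ∀ a : A, TensorProduct.assoc k A H H (coact.toLinearMap.rTensor H (coact a)) =
    (Coalgebra.comul (R := k) (A := H)).lTensor A (coact a)
  /-- `(id ⊗ ε) ∘ ρ = id ⊗ 1`. -/
  counit_coact : ∀ a : A,
    (Coalgebra.counit (R := k) (A := H)).lTensor A (coact a) = a ⊗ₜ[k] (1 : k)

section Coinvariants

variable (k : Type*) (H : Type*) (A : Type*) [CommRing k] [Ring H] [Bialgebra k H]
  [Ring A] [Algebra k A] [RightComoduleAlgebra k H A]

/-- The coaction `ρ : A → A ⊗ H` of a right `H`-comodule algebra. -/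
abbrev coaction : A →ₐ[k] A ⊗[k] H := RightComoduleAlgebra.coact

/-- The subalgebra `A^{co H} = {a | ρ a = a ⊗ 1}` of coinvariants. -/
def coinvariants : Subalgebra k A :=
  AlgHom.equalizer (coaction k H A) Algebra.TensorProduct.includeLeft

end Coinvariants

section Balanced

variable (k : Type*) [CommRing k]

/-- A `k`-algebra `A` is a right module over each of its subalgebras `B`, by right
multiplication: `op b • a = a * b`. -/
instance subalgebraRightModule {A : Type*} [Ring A] [Algebra k A] (B : Subalgebra k A) :
    Module (↥B)ᵐᵒᵖ A :=
  Module.compHom A B.val.toRingHom.op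

variable (B : Type*) [Ring B] [Algebra k B]
  (M : Type*) [AddCommGroup M] [Module k M] [Module Bᵐᵒᵖ M]
  (N : Type*) [AddCommGroup N] [Module k N] [Module B N]

/-- The relations `m b ⊗ n = m ⊗ b n` in `M ⊗[k] N`, for a right `B`-module `M` and a left
`B`-module `N`. -/
def balancedRelations : Submodule k (M ⊗[k] N) :=
  Submodule.span k {x | ∃ (m : M) (b : B) (n : N),
    x = (MulOpposite.op b • m) ⊗ₜ[k] n - m ⊗ₜ[k] (b • n)}

/-- The tensor product `M ⊗_B N` over a possibly noncommutative `k`-algebra `B` of a right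
`B`-module `M` and a left `B`-module `N`, as a quotient of `M ⊗[k] N`. -/
abbrev BalancedTensor : Type _ := (M ⊗[k] N) ⧸ balancedRelations k B M N

variable {M}
variable {M' : Type*} [AddCommGroup M'] [Module k M'] [Module Bᵐᵒᵖ M']

/-- The map `f ⊗_B N : M ⊗_B N → M' ⊗_B N` induced by a map `f : M → M'` of right
`B`-modules. -/
def BalancedTensor.map [IsScalarTower k Bᵐᵒᵖ M] [IsScalarTower k Bᵐᵒᵖ M']
    (f : M →ₗ[Bᵐᵒᵖ] M') : BalancedTensor k B M N →ₗ[k] BalancedTensor k B M' N :=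
  Submodule.mapQ (balancedRelations k B M N) (balancedRelations k B M' N)
    ((f.restrictScalars k).rTensor N) (by
      refine Submodule.span_le.2 ?_
      rintro _ ⟨m, b, n, rfl⟩
      refine Submodule.subset_span ⟨f m, b, n, ?_⟩
      simp)

end Balanced

/-- A left module `N` over a (possibly noncommutative) `k`-algebra `B` is faithfully flat if the
functor `- ⊗_B N` on right `B`-modules preserves and reflects exact sequences. The compatible
`k`-module structure of a right `B`-module is the one it inherits from `B`. -/
def LeftFaithfullyFlat (k : Type v) [CommRing k] (B : Type u) [Ring B] [Algebra k B]
    (N : Type u) [AddCommGroup N] [Module k N] [Module B N] : Prop :=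
  ∀ (M₁ M₂ M₃ : Type u) [AddCommGroup M₁] [AddCommGroup M₂] [AddCommGroup M₃]
    [Module k M₁] [Module k M₂] [Module k M₃]
    [Module Bᵐᵒᵖ M₁] [Module Bᵐᵒᵖ M₂] [Module Bᵐᵒᵖ M₃]
    [IsScalarTower k Bᵐᵒᵖ M₁] [IsScalarTower k Bᵐᵒᵖ M₂] [IsScalarTower k Bᵐᵒᵖ M₃]
    (f : M₁ →ₗ[Bᵐᵒᵖ] M₂) (g : M₂ →ₗ[Bᵐᵒᵖ] M₃),
    Function.Exact f g ↔
      Function.Exact (BalancedTensor.map k B N f) (BalancedTensor.map k B N g)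

section Galois

variable (k : Type*) (H : Type*) (A : Type*) [CommRing k] [Ring H] [Bialgebra k H]
  [Ring A] [Algebra k A] [RightComoduleAlgebra k H A]

/-- The map `A ⊗[k] A → A ⊗ H`, `a ⊗ a' ↦ a a'₀ ⊗ a'₁`. -/
def canAux : A ⊗[k] A →ₗ[k] A ⊗[k] H :=
  LinearMap.mul' k (A ⊗[k] H) ∘ₗ
    TensorProduct.map (Algebra.TensorProduct.includeLeft (R := k) (S := k) (A := A)
      (B := H)).toLinearMap (coaction k H A).toLinearMap

lemma canAux_tmul (a a' : A) :
    canAux k H A (a ⊗ₜ[k] a') = (a ⊗ₜ[k] (1 : H)) * coaction k H A a' := rfl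

/-- The canonical map `can : A ⊗_B A → A ⊗ H`, `can (a ⊗_B a') = a a'₀ ⊗ a'₁`, where
`B = A^{co H}`. -/
def can : BalancedTensor k (coinvariants k H A) A A →ₗ[k] A ⊗[k] H :=
  Submodule.liftQ (balancedRelations k (coinvariants k H A) A A) (canAux k H A) (by
    refine Submodule.span_le.2 ?_
    rintro _ ⟨a, b, a', rfl⟩
    have hb : coaction k H A (b : A) = (b : A) ⊗ₜ[k] (1 : H) := b.2
    have h1 : MulOpposite.op b • a = a * (b : A) := rfl
    have h2 : b • a' = (b : A) * a' := rfl
    simp [h1, h2, canAux_tmul, hb, ← mul_assoc])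

end Galois

/-- The right `H`-comodule algebra `A` is a faithfully flat `H`-Galois extension of its
subalgebra of coinvariants `B = A^{co H}`: the canonical map `A ⊗_B A → A ⊗ H` is bijective and
`A` is faithfully flat as a left `B`-module. -/
def IsFaithfullyFlatGalois (k : Type v) (H : Type w) (A : Type u) [CommRing k] [Ring H]
    [Bialgebra k H] [Ring A] [Algebra k A] [RightComoduleAlgebra k H A] : Prop :=
  Function.Bijective (can k H A) ∧ LeftFaithfullyFlat k (coinvariants k H A) A

section Cotensor

variable (k : Type*) (H : Type*) (A A' : Type*)

section Defs

variable [CommRing k] [Ring H] [Bialgebra k H]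
  [Ring A] [Algebra k A] [RightComoduleAlgebra k H A]
  [Ring A'] [Algebra k A'] [RightComoduleAlgebra k H A']

/-- `A ⊗ A' → (A ⊗ A') ⊗ H`, `a ⊗ a' ↦ a₀ ⊗ a' ⊗ a₁`. -/
def coactLeft : A ⊗[k] A' →ₐ[k] (A ⊗[k] A') ⊗[k] H :=
  ((Algebra.TensorProduct.assoc k k k A A' H).symm.toAlgHom.comp
    ((Algebra.TensorProduct.map (AlgHom.id k A)
      (Algebra.TensorProduct.comm k H A').toAlgHom).comp
        (Algebra.TensorProduct.assoc k k k A H A').toAlgHom)).comp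
    (Algebra.TensorProduct.map (coaction k H A) (AlgHom.id k A'))

/-- `A ⊗ A' → (A ⊗ A') ⊗ H`, `a ⊗ a' ↦ a ⊗ a'₀ ⊗ a'₁`. -/
def coactRight : A ⊗[k] A' →ₐ[k] (A ⊗[k] A') ⊗[k] H :=
  (Algebra.TensorProduct.assoc k k k A A' H).symm.toAlgHom.comp
    (Algebra.TensorProduct.map (AlgHom.id k A) (coaction k H A'))

/-- The cotensor product `A □_H A'` for cocommutative `H`, that is, the subalgebra of those
`∑ aᵢ ⊗ a'ᵢ` in `A ⊗ A'` for which `∑ aᵢ₀ ⊗ a'ᵢ ⊗ aᵢ₁ = ∑ aᵢ ⊗ a'ᵢ₀ ⊗ a'ᵢ₁`. (The right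
`H`-comodule `A'` is regarded as a left `H`-comodule by flipping its coaction.) -/
def cotensor : Subalgebra k (A ⊗[k] A') :=
  AlgHom.equalizer (coactLeft k H A A') (coactRight k H A A')

end Defs
section Lemmas

set_option linter.unusedSectionVars false

variable {k : Type*} {H : Type*} {A A' : Type*}
variable [CommRing k] [Ring H] [Bialgebra k H]
  [Ring A] [Algebra k A] [RightComoduleAlgebra k H A]
  [Ring A'] [Algebra k A'] [RightComoduleAlgebra k H A']

lemma coactLeft_tmul (a : A) (a' : A') :
    coactLeft k H A A' (a ⊗ₜ a') =
      TensorProduct.rightComm k A H A' (coaction k H A a ⊗ₜ[k] a') := by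
  simp only [coactLeft, AlgHom.comp_apply, Algebra.TensorProduct.map_tmul]
  induction coaction k H A a using TensorProduct.induction_on with
  | zero => simp
  | tmul x h => rfl
  | add x y hx hy =>
    simp only [TensorProduct.add_tmul, map_add] at *
    rw [hx, hy]

lemma coactRight_tmul (a : A) (a' : A') :
    coactRight k H A A' (a ⊗ₜ a') =
      (TensorProduct.assoc k A A' H).symm (a ⊗ₜ[k] coaction k H A' a') := rfl

/-- The flip of the last two factors in `(V ⊗ H) ⊗ H`. -/
abbrev flipHH (k H V : Type*) [CommRing k] [Ring H] [Algebra k H] [AddCommGroup V] [Module k V] :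
    (V ⊗[k] H) ⊗[k] H ≃ₗ[k] (V ⊗[k] H) ⊗[k] H :=
  TensorProduct.rightComm k V H H

lemma coactRight_coassoc (x : A ⊗[k] A') :
    TensorProduct.assoc k (A ⊗[k] A') H H
      ((coactRight k H A A').toLinearMap.rTensor H (coactRight k H A A' x)) =
    (Coalgebra.comul (R := k) (A := H)).lTensor (A ⊗[k] A') (coactRight k H A A' x) := by
  induction x using TensorProduct.induction_on with
  | zero => simp
  | add x y hx hy => simp only [map_add, hx, hy]
  | tmul a a' =>
    have h := congrArg (fun t => (TensorProduct.assoc k A A' (H ⊗[k] H)).symm (a ⊗ₜ[k] t))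
      (RightComoduleAlgebra.coassoc (k := k) (H := H) a')
    rw [coactRight_tmul]
    refine Eq.trans ?_ (h.trans ?_)
    · induction coaction k H A' a' using TensorProduct.induction_on with
      | zero => simp
      | add x y hx hy => simp only [TensorProduct.tmul_add, map_add, hx, hy]
      | tmul b g =>
        simp only [TensorProduct.assoc_symm_tmul, LinearMap.rTensor_tmul,
          AlgHom.toLinearMap_apply, coactRight_tmul]
        induction coaction k H A' b using TensorProduct.induction_on with
        | zero => simp
        | add x y hx hy =>
          simp only [TensorProduct.tmul_add, TensorProduct.add_tmul, map_add, hx, hy]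
        | tmul c g' => rfl
    · induction coaction k H A' a' using TensorProduct.induction_on with
      | zero => simp
      | add x y hx hy => simp only [TensorProduct.tmul_add, map_add, hx, hy]
      | tmul b g =>
        simp only [TensorProduct.assoc_symm_tmul, LinearMap.lTensor_tmul]

lemma coactRight_counit (x : A ⊗[k] A') :
    (Coalgebra.counit (R := k) (A := H)).lTensor (A ⊗[k] A') (coactRight k H A A' x) =
      x ⊗ₜ[k] (1 : k) := by
  induction x using TensorProduct.induction_on with
  | zero => simp
  | add x y hx hy => simp only [map_add, hx, hy, TensorProduct.add_tmul]
  | tmul a a' =>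
    have h := congrArg (fun t => (TensorProduct.assoc k A A' k).symm (a ⊗ₜ[k] t))
      (RightComoduleAlgebra.counit_coact (k := k) (H := H) a')
    rw [coactRight_tmul]
    refine Eq.trans ?_ (h.trans ?_)
    · induction coaction k H A' a' using TensorProduct.induction_on with
      | zero => simp
      | add x y hx hy => simp only [TensorProduct.tmul_add, map_add, hx, hy]
      | tmul b g =>
        simp only [TensorProduct.assoc_symm_tmul, LinearMap.lTensor_tmul]
    · simp only [TensorProduct.assoc_symm_tmul]

lemma coactLeft_coactRight (x : A ⊗[k] A') :
    (coactLeft k H A A').toLinearMap.rTensor H (coactRight k H A A' x) =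
      flipHH k H (A ⊗[k] A')
        ((coactRight k H A A').toLinearMap.rTensor H (coactLeft k H A A' x)) := by
  induction x using TensorProduct.induction_on with
  | zero => simp
  | add x y hx hy => simp only [map_add, hx, hy]
  | tmul a a' =>
    have h1 : ∀ Q : A' ⊗[k] H, (coactLeft k H A A').toLinearMap.rTensor H
        ((TensorProduct.assoc k A A' H).symm (a ⊗ₜ[k] Q)) =
        (TensorProduct.rightComm k A H A').toLinearMap.rTensor H
          ((TensorProduct.assoc k (A ⊗[k] H) A' H).symm (coaction k H A a ⊗ₜ[k] Q)) := by
      intro Q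
      induction Q using TensorProduct.induction_on with
      | zero => simp
      | add x y hx hy => simp only [TensorProduct.tmul_add, map_add, hx, hy]
      | tmul b g =>
        simp only [TensorProduct.assoc_symm_tmul, LinearMap.rTensor_tmul,
          AlgHom.toLinearMap_apply, coactLeft_tmul, LinearEquiv.coe_coe]
    have h2 : ∀ P : A ⊗[k] H, (coactRight k H A A').toLinearMap.rTensor H
        (TensorProduct.rightComm k A H A' (P ⊗ₜ[k] a')) =
        (TensorProduct.assoc k A A' H).symm.toLinearMap.rTensor H
          (TensorProduct.rightComm k A H (A' ⊗[k] H) (P ⊗ₜ[k] coaction k H A' a')) := by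
      intro P
      induction P using TensorProduct.induction_on with
      | zero => simp
      | add x y hx hy => simp only [TensorProduct.add_tmul, map_add, hx, hy]
      | tmul c h =>
        simp only [TensorProduct.rightComm_tmul, LinearMap.rTensor_tmul,
          AlgHom.toLinearMap_apply, coactRight_tmul, LinearEquiv.coe_coe]
    have h3 : ∀ (P : A ⊗[k] H) (Q : A' ⊗[k] H),
        (TensorProduct.rightComm k A H A').toLinearMap.rTensor H
          ((TensorProduct.assoc k (A ⊗[k] H) A' H).symm (P ⊗ₜ[k] Q)) =
        flipHH k H (A ⊗[k] A') ((TensorProduct.assoc k A A' H).symm.toLinearMap.rTensor H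
          (TensorProduct.rightComm k A H (A' ⊗[k] H) (P ⊗ₜ[k] Q))) := by
      intro P Q
      induction P using TensorProduct.induction_on with
      | zero => simp
      | add x y hx hy => simp only [TensorProduct.add_tmul, map_add, hx, hy]
      | tmul c h =>
        induction Q using TensorProduct.induction_on with
        | zero => simp
        | add x y hx hy => simp only [TensorProduct.tmul_add, map_add, hx, hy]
        | tmul b g => rfl
    rw [coactRight_tmul, coactLeft_tmul, h1, h2, h3]

lemma coactRight_flip [Coalgebra.IsCocomm k H] (x : A ⊗[k] A') :
    flipHH k H (A ⊗[k] A')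
        ((coactRight k H A A').toLinearMap.rTensor H (coactRight k H A A' x)) =
      (coactRight k H A A').toLinearMap.rTensor H (coactRight k H A A' x) := by
  apply (TensorProduct.assoc k (A ⊗[k] A') H H).injective
  have h : ∀ z : ((A ⊗[k] A') ⊗[k] H) ⊗[k] H,
      TensorProduct.assoc k (A ⊗[k] A') H H (flipHH k H (A ⊗[k] A') z) =
        (TensorProduct.comm k H H).toLinearMap.lTensor (A ⊗[k] A')
          (TensorProduct.assoc k (A ⊗[k] A') H H z) := by
    intro z
    induction z using TensorProduct.induction_on with
    | zero => simp
    | add x y hx hy => simp only [map_add, hx, hy]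
    | tmul y g =>
      induction y using TensorProduct.induction_on with
      | zero => simp
      | add x y hx hy => simp only [TensorProduct.add_tmul, map_add, hx, hy]
      | tmul y g' => rfl
  rw [h, coactRight_coassoc, ← LinearMap.lTensor_comp_apply, Coalgebra.comm_comp_comul]

end Lemmas

section Field

variable (k : Type*) (H : Type*) (A A' : Type*)
variable [Field k] [Ring H] [Bialgebra k H]
  [Ring A] [Algebra k A] [RightComoduleAlgebra k H A]
  [Ring A'] [Algebra k A'] [RightComoduleAlgebra k H A']

/-- The inclusion `(A □_H A') ⊗ H → (A ⊗ A') ⊗ H`. -/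
def cotensorIncl : cotensor k H A A' ⊗[k] H →ₐ[k] (A ⊗[k] A') ⊗[k] H :=
  Algebra.TensorProduct.map (cotensor k H A A').val (AlgHom.id k H)

lemma cotensorIncl_eq (z : cotensor k H A A' ⊗[k] H) :
    cotensorIncl k H A A' z = (cotensor k H A A').val.toLinearMap.rTensor H z := rfl

lemma cotensorIncl_injective : Function.Injective (cotensorIncl k H A A') :=
  Module.Flat.rTensor_preserves_injective_linearMap (M := H)
    (cotensor k H A A').val.toLinearMap Subtype.val_injective

variable {k H A A'} in
lemma coactRight_mem_range [Coalgebra.IsCocomm k H] (x : cotensor k H A A') :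
    coactRight k H A A' (x : A ⊗[k] A') ∈ (cotensorIncl k H A A').range := by
  have hx : coactLeft k H A A' (x : A ⊗[k] A') = coactRight k H A A' x := x.2
  have hex : Function.Exact (cotensor k H A A').val.toLinearMap
      ((coactLeft k H A A').toLinearMap - (coactRight k H A A').toLinearMap) := by
    intro y
    constructor
    · intro hy
      exact ⟨⟨y, sub_eq_zero.1 hy⟩, rfl⟩
    · rintro ⟨y, rfl⟩
      exact sub_eq_zero.2 y.2
  have key : (coactLeft k H A A').toLinearMap.rTensor H (coactRight k H A A' x) =
      (coactRight k H A A').toLinearMap.rTensor H (coactRight k H A A' x) := by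
    rw [coactLeft_coactRight, hx, coactRight_flip]
  have h := Module.Flat.rTensor_exact H hex
  obtain ⟨z, hz⟩ := (h (coactRight k H A A' (x : A ⊗[k] A'))).1 (by
    rw [LinearMap.rTensor_sub]
    exact sub_eq_zero.2 key)
  exact ⟨z, hz⟩

/-- The coaction `∑ aᵢ ⊗ a'ᵢ ↦ ∑ aᵢ ⊗ a'ᵢ₀ ⊗ a'ᵢ₁ = ∑ aᵢ₀ ⊗ a'ᵢ ⊗ aᵢ₁` of `H` on
`A □_H A'`. -/
def cotensorCoact [Coalgebra.IsCocomm k H] :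
    cotensor k H A A' →ₐ[k] cotensor k H A A' ⊗[k] H :=
  ((AlgEquiv.ofInjective (cotensorIncl k H A A')
    (cotensorIncl_injective k H A A')).symm.toAlgHom).comp
    (((coactRight k H A A').comp (cotensor k H A A').val).codRestrict
      (cotensorIncl k H A A').range coactRight_mem_range)

variable {k H A A'} in
lemma cotensorIncl_coact [Coalgebra.IsCocomm k H] (x : cotensor k H A A') :
    (cotensor k H A A').val.toLinearMap.rTensor H (cotensorCoact k H A A' x) =
      coactRight k H A A' x :=
  congrArg Subtype.val ((AlgEquiv.ofInjective (cotensorIncl k H A A')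
    (cotensorIncl_injective k H A A')).apply_symm_apply
      (⟨coactRight k H A A' x, coactRight_mem_range x⟩ : (cotensorIncl k H A A').range))

/-- For cocommutative `H`, the cotensor product of two right `H`-comodule algebras is a right
`H`-comodule algebra. -/
instance cotensorComoduleAlgebra [Coalgebra.IsCocomm k H] :
    RightComoduleAlgebra k H (cotensor k H A A') where
  coact := cotensorCoact k H A A'
  coassoc x := by
    have hinj := Module.Flat.rTensor_preserves_injective_linearMap (M := H ⊗[k] H)
      (cotensor k H A A').val.toLinearMap Subtype.val_injective
    apply hinj
    have e1 : ∀ z : cotensor k H A A' ⊗[k] H,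
        (cotensor k H A A').val.toLinearMap.rTensor (H ⊗[k] H)
          (TensorProduct.assoc k _ H H ((cotensorCoact k H A A').toLinearMap.rTensor H z)) =
        TensorProduct.assoc k _ H H ((coactRight k H A A').toLinearMap.rTensor H
          ((cotensor k H A A').val.toLinearMap.rTensor H z)) := by
      intro z
      induction z using TensorProduct.induction_on with
      | zero => simp
      | add x y hx hy => simp only [map_add, hx, hy]
      | tmul y g =>
        simp only [LinearMap.rTensor_tmul, AlgHom.toLinearMap_apply, Subalgebra.coe_val]
        rw [← cotensorIncl_coact]
        induction cotensorCoact k H A A' y using TensorProduct.induction_on with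
        | zero => simp
        | add x y hx hy => simp only [TensorProduct.add_tmul, map_add, hx, hy]
        | tmul c g' => rfl
    have e2 : ∀ z : cotensor k H A A' ⊗[k] H,
        (cotensor k H A A').val.toLinearMap.rTensor (H ⊗[k] H)
          ((Coalgebra.comul (R := k) (A := H)).lTensor _ z) =
        (Coalgebra.comul (R := k) (A := H)).lTensor _
          ((cotensor k H A A').val.toLinearMap.rTensor H z) := by
      intro z
      induction z using TensorProduct.induction_on with
      | zero => simp
      | add x y hx hy => simp only [map_add, hx, hy]
      | tmul y g => rfl
    rw [e1, e2, cotensorIncl_coact, coactRight_coassoc]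
  counit_coact x := by
    have hinj := Module.Flat.rTensor_preserves_injective_linearMap (M := k)
      (cotensor k H A A').val.toLinearMap Subtype.val_injective
    apply hinj
    have e2 : ∀ z : cotensor k H A A' ⊗[k] H,
        (cotensor k H A A').val.toLinearMap.rTensor k
          ((Coalgebra.counit (R := k) (A := H)).lTensor _ z) =
        (Coalgebra.counit (R := k) (A := H)).lTensor _
          ((cotensor k H A A').val.toLinearMap.rTensor H z) := by
      intro z
      induction z using TensorProduct.induction_on with
      | zero => simp
      | add x y hx hy => simp only [map_add, hx, hy]
      | tmul y g => rfl
    rw [e2, cotensorIncl_coact, coactRight_counit]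
    rfl

end Field

end Cotensor

end HopfGalois

end

/-! Write `R = A □_H A'` and `C = A ⊗ A'`, with its two commuting coactions `δ` (from `A`) and `δ'`
(from `A'`). Over a field, tensoring is exact, so an element of `C` invariant under both `δ` and
`δ'` lies in `B ⊗ B'`; this gives the coinvariants `D` of `R` (`toCoinvariantsCotensor_bijective`).

The heart is that multiplication induces `R ⊗_{B'} A' ≅ C` (`presents_mulRightFactor_cotensor`). By
definition `R` is the kernel of `δ - δ'`, a right `B'`-linear map, so flatness of `A'` makes `R
⊗_{B'} A'` the kernel of the induced map. Since `A'` is Galois, `C ⊗_{B'} A' ≅ C ⊗ H`, and the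
kernel becomes the set of `z = ∑ c ⊗ h` with `∑ c₀ ⊗ c₁h₁ ⊗ h₂ = ∑ δ'(c) ⊗ h`, where `c₀ ⊗ c₁ =
δ(c)`. Applying `ε` to the last factor gives `twist δ z = δ'(x)` with `x = (id ⊗ ε)(z)`. The
antipode inverts `twist δ`, so `x` determines `z`; conversely `untwist δ (δ' x)` solves the equation
because `H` is cocommutative and `δ`, `δ'` commute (`exists_evalCounit_eq`).

Everything else is descent along `B' → A'`. For a right `D`-module `M`, `(M ⊗_D R) ⊗_{B'} A' ≅ M ⊗_D
C ≅ (M ⊗_B A) ⊗_{B'} A'`, so faithful flatness of `R` follows from that of `A` and `A'`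
(`CotensorExtension.exact_iff`). For the canonical map, `(R ⊗_D R) ⊗_{B'} A' ≅ R ⊗_D C ≅ C ⊗_B A ≅ C
⊗ H` because `A` is Galois, while `(R ⊗ H) ⊗_{B'} A' ≅ C ⊗ H`; the canonical map becomes the
identity, hence was bijective (`CotensorExtension.presents_canMap`).

Balanced tensor products are handled through `Presents`: a model is any surjection from a tensor
product over `k` whose kernel is spanned by the balancing relations. Iterated quotients and
reassociations then reduce to comparing relations. -/

noncomputable section

namespace HopfGalois

/-! ### Quotients presented by endomorphisms. -/

section Presentations

variable {k : Type*} [CommRing k]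
variable {X Y Z W : Type*} [AddCommGroup X] [Module k X] [AddCommGroup Y] [Module k Y]
  [AddCommGroup Z] [Module k Z] [AddCommGroup W] [Module k W]
variable {ι κ : Type*}

/-- `Φ` is a surjection whose kernel is generated by the ranges of the endomorphisms `d i`. -/
structure Presents (d : ι → Module.End k X) (Φ : X →ₗ[k] Y) : Prop where
  surjective : Function.Surjective Φ
  ker_eq : LinearMap.ker Φ = ⨆ i, LinearMap.range (d i)

namespace Presents

lemma apply_rel {d : ι → Module.End k X} {Φ : X →ₗ[k] Y} (h : Presents d Φ) (i : ι) (x : X) :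
    Φ (d i x) = 0 := by
  have : d i x ∈ LinearMap.ker Φ := by
    rw [h.ker_eq]
    exact Submodule.mem_iSup_of_mem i ⟨x, rfl⟩
  exact this

lemma comp_rel {d : ι → Module.End k X} {Φ : X →ₗ[k] Y} (h : Presents d Φ) (i : ι) :
    Φ ∘ₗ d i = 0 :=
  LinearMap.ext (h.apply_rel i)

lemma mkQ (d : ι → Module.End k X) : Presents d (⨆ i, LinearMap.range (d i)).mkQ :=
  ⟨Submodule.mkQ_surjective _, Submodule.ker_mkQ _⟩

/-- Quotient in stages: the kernel of the composite is the preimage of `ker Ψ`, generated by `ker Φ`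
and by lifts `e'` of the second family of relations. -/
lemma comp {d : ι → Module.End k X} {Φ : X →ₗ[k] Y} (h : Presents d Φ)
    {e : κ → Module.End k Y} {Ψ : Y →ₗ[k] Z} (h' : Presents e Ψ)
    (e' : κ → Module.End k X) (he : ∀ j, Φ ∘ₗ e' j = e j ∘ₗ Φ) :
    Presents (Sum.elim d e') (Ψ ∘ₗ Φ) where
  surjective := h'.surjective.comp h.surjective
  ker_eq := by
    have hr : ∀ j, LinearMap.range (e j) = (LinearMap.range (e' j)).map Φ := fun j => by
      rw [← LinearMap.range_comp, he, LinearMap.range_comp_of_range_eq_top _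
        (LinearMap.range_eq_top.2 h.surjective)]
    rw [LinearMap.ker_comp, h'.ker_eq, iSup_sum]
    simp only [hr, Sum.elim_inl, Sum.elim_inr]
    rw [← Submodule.map_iSup, Submodule.comap_map_eq, h.ker_eq, sup_comm]

/-- Converse of `comp`: push the kernel of the composite forward along `Φ`; the relations `d` die
and the `e'` become the `e`. Only surjectivity of `Φ` is needed, not that `d` generates its kernel.
-/
lemma of_comp {d : ι → Module.End k X} {e' : κ → Module.End k X} {Φ : X →ₗ[k] Y}
    (hΦ : Function.Surjective Φ) {e : κ → Module.End k Y} {Ψ : Y →ₗ[k] Z}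
    (h : Presents (Sum.elim d e') (Ψ ∘ₗ Φ)) (hd : ∀ i, Φ ∘ₗ d i = 0)
    (he : ∀ j, Φ ∘ₗ e' j = e j ∘ₗ Φ) : Presents e Ψ where
  surjective := Function.Surjective.of_comp (g := Φ) h.surjective
  ker_eq := by
    have hr : ∀ j, LinearMap.range (e j) = (LinearMap.range (e' j)).map Φ := fun j => by
      rw [← LinearMap.range_comp, he, LinearMap.range_comp_of_range_eq_top _
        (LinearMap.range_eq_top.2 hΦ)]
    have hr' : ∀ i, (LinearMap.range (d i)).map Φ = ⊥ := fun i => by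
      rw [← LinearMap.range_comp, hd, LinearMap.range_zero]
    have := congrArg (Submodule.map Φ) h.ker_eq
    rw [LinearMap.ker_comp, Submodule.map_comap_eq_of_surjective hΦ, iSup_sum, Submodule.map_sup,
      Submodule.map_iSup, Submodule.map_iSup] at this
    simpa [hr, hr'] using this

lemma conj {d : ι → Module.End k Y} {Φ : Y →ₗ[k] Z} (h : Presents d Φ) (e : X ≃ₗ[k] Y)
    (d' : ι → Module.End k X) (hd : ∀ i, e.toLinearMap ∘ₗ d' i = d i ∘ₗ e.toLinearMap) :
    Presents d' (Φ ∘ₗ e.toLinearMap) where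
  surjective := h.surjective.comp e.surjective
  ker_eq := by
    have hr : ∀ j, LinearMap.range (d j) = (LinearMap.range (d' j)).map e.toLinearMap :=
      fun j => by
        rw [← LinearMap.range_comp, hd, LinearMap.range_comp_of_range_eq_top _ e.range]
    rw [LinearMap.ker_comp, h.ker_eq]
    simp only [hr]
    rw [← Submodule.map_iSup, Submodule.comap_map_eq_of_injective e.injective]

lemma equiv_comp {d : ι → Module.End k X} {Φ : X →ₗ[k] Y} (h : Presents d Φ) (e : Y ≃ₗ[k] Z) :
    Presents d (e.toLinearMap ∘ₗ Φ) where
  surjective := e.surjective.comp h.surjective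
  ker_eq := by rw [LinearEquiv.ker_comp, h.ker_eq]

lemma congr_rel {d : ι → Module.End k X} {Φ : X →ₗ[k] Y} (h : Presents d Φ)
    {e : κ → Module.End k X}
    (he : (⨆ i, LinearMap.range (d i)) = ⨆ j, LinearMap.range (e j)) : Presents e Φ :=
  ⟨h.surjective, h.ker_eq.trans he⟩

/-- Right exactness of the tensor product; no flatness of `W` enters. -/
lemma rTensor {d : ι → Module.End k X} {Φ : X →ₗ[k] Y} (h : Presents d Φ) (W : Type*)
    [AddCommGroup W] [Module k W] :
    Presents (fun i => (d i).rTensor W) (Φ.rTensor W) where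
  surjective := LinearMap.rTensor_surjective W h.surjective
  ker_eq := by
    apply le_antisymm
    · rw [(rTensor_exact W (LinearMap.exact_subtype_ker_map Φ) h.surjective).linearMap_ker_eq]
      rintro _ ⟨z, rfl⟩
      induction z using TensorProduct.induction_on with
      | zero => simp
      | add x y hx hy => rw [map_add]; exact add_mem hx hy
      | tmul x w =>
        have hx : (x : X) ∈ ⨆ i, LinearMap.range (d i) := h.ker_eq ▸ x.2
        simp only [LinearMap.rTensor_tmul, Submodule.subtype_apply]
        refine Submodule.iSup_induction _ (motive := fun y : X => y ⊗ₜ[k] w ∈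
          ⨆ i, LinearMap.range ((d i).rTensor W)) hx ?_ ?_ ?_
        · rintro i _ ⟨y, rfl⟩
          exact Submodule.mem_iSup_of_mem i ⟨y ⊗ₜ w, by simp⟩
        · simp
        · intro x y hx hy
          rw [TensorProduct.add_tmul]
          exact add_mem hx hy
    · refine iSup_le fun i => ?_
      rintro _ ⟨z, rfl⟩
      rw [LinearMap.mem_ker, ← LinearMap.rTensor_comp_apply]
      rw [h.comp_rel]
      simp

lemma lTensor {d : ι → Module.End k X} {Φ : X →ₗ[k] Y} (h : Presents d Φ) (W : Type*)
    [AddCommGroup W] [Module k W] :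
    Presents (fun i => (d i).lTensor W) (Φ.lTensor W) := by
  have := ((h.rTensor W).equiv_comp (TensorProduct.comm k Y W)).conj
    (TensorProduct.comm k W X) (fun i => (d i).lTensor W) (fun i => by ext; simp)
  convert this using 1
  ext; simp

/-- The map induced on presented modules. -/
lemma exists_lift {d : ι → Module.End k X} {Φ : X →ₗ[k] Y} (h : Presents d Φ) (g : X →ₗ[k] Z)
    (hg : ∀ i, g ∘ₗ d i = 0) : ∃ g' : Y →ₗ[k] Z, g' ∘ₗ Φ = g := by
  have hle : LinearMap.ker Φ ≤ LinearMap.ker g := by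
    rw [h.ker_eq]
    refine iSup_le fun i => ?_
    rintro _ ⟨x, rfl⟩
    exact LinearMap.congr_fun (hg i) x
  refine ⟨(LinearMap.ker Φ).liftQ g hle ∘ₗ (Φ.quotKerEquivOfSurjective h.surjective).symm, ?_⟩
  ext x
  have : (Φ.quotKerEquivOfSurjective h.surjective).symm (Φ x) = Submodule.Quotient.mk x := by
    rw [LinearEquiv.symm_apply_eq]; rfl
  simp [this]

end Presents

/-- Pulling `ker g' = range f'` back along the surjection `p₂` expresses exactness through the
kernels of `p₂` and `p₃` alone, so it does not depend on the models of the quotients. -/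
lemma exact_iff_comap_eq {X₁ X₂ X₃ Y₁ Y₂ Y₃ : Type*}
    [AddCommGroup X₁] [Module k X₁] [AddCommGroup X₂] [Module k X₂]
    [AddCommGroup X₃] [Module k X₃]
    [AddCommGroup Y₁] [Module k Y₁] [AddCommGroup Y₂] [Module k Y₂]
    [AddCommGroup Y₃] [Module k Y₃]
    {f : X₁ →ₗ[k] X₂} {g : X₂ →ₗ[k] X₃}
    {p₁ : X₁ →ₗ[k] Y₁} {p₂ : X₂ →ₗ[k] Y₂} {p₃ : X₃ →ₗ[k] Y₃}
    (h₁ : Function.Surjective p₁) (h₂ : Function.Surjective p₂)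
    {f' : Y₁ →ₗ[k] Y₂} {g' : Y₂ →ₗ[k] Y₃}
    (hf : f' ∘ₗ p₁ = p₂ ∘ₗ f) (hg : g' ∘ₗ p₂ = p₃ ∘ₗ g) :
    Function.Exact f' g' ↔
      (LinearMap.ker p₃).comap g = LinearMap.range f ⊔ LinearMap.ker p₂ := by
  rw [LinearMap.exact_iff, ← (Submodule.comap_injective_of_surjective h₂).eq_iff,
    ← LinearMap.ker_comp, hg, LinearMap.ker_comp,
    ← LinearMap.range_comp_of_range_eq_top f' (LinearMap.range_eq_top.2 h₁), hf,
    LinearMap.range_comp, Submodule.comap_map_eq]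

/-- Exactness of a pair of maps between quotients only depends on the kernels of the quotient
maps. -/
lemma exact_iff_of_ker_eq {X₁ X₂ X₃ Y₁ Y₂ Y₃ Z₁ Z₂ Z₃ : Type*}
    [AddCommGroup X₁] [Module k X₁] [AddCommGroup X₂] [Module k X₂]
    [AddCommGroup X₃] [Module k X₃]
    [AddCommGroup Y₁] [Module k Y₁] [AddCommGroup Y₂] [Module k Y₂]
    [AddCommGroup Y₃] [Module k Y₃]
    [AddCommGroup Z₁] [Module k Z₁] [AddCommGroup Z₂] [Module k Z₂]
    [AddCommGroup Z₃] [Module k Z₃]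
    {f : X₁ →ₗ[k] X₂} {g : X₂ →ₗ[k] X₃}
    {p₁ : X₁ →ₗ[k] Y₁} {p₂ : X₂ →ₗ[k] Y₂} {p₃ : X₃ →ₗ[k] Y₃}
    {q₁ : X₁ →ₗ[k] Z₁} {q₂ : X₂ →ₗ[k] Z₂} {q₃ : X₃ →ₗ[k] Z₃}
    (hp₁ : Function.Surjective p₁) (hp₂ : Function.Surjective p₂)
    (hq₁ : Function.Surjective q₁) (hq₂ : Function.Surjective q₂)
    (h₂ : LinearMap.ker p₂ = LinearMap.ker q₂)
    (h₃ : LinearMap.ker p₃ = LinearMap.ker q₃)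
    {fp : Y₁ →ₗ[k] Y₂} {gp : Y₂ →ₗ[k] Y₃} {fq : Z₁ →ₗ[k] Z₂} {gq : Z₂ →ₗ[k] Z₃}
    (hfp : fp ∘ₗ p₁ = p₂ ∘ₗ f) (hgp : gp ∘ₗ p₂ = p₃ ∘ₗ g)
    (hfq : fq ∘ₗ q₁ = q₂ ∘ₗ f) (hgq : gq ∘ₗ q₂ = q₃ ∘ₗ g) :
    Function.Exact fp gp ↔ Function.Exact fq gq := by
  rw [exact_iff_comap_eq hp₁ hp₂ hfp hgp, exact_iff_comap_eq hq₁ hq₂ hfq hgq, h₂, h₃]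

end Presentations

/-! ### Balancing relations and flatness in terms of presentations. -/

section Relations

variable {k : Type*} [CommRing k] {B : Type*} [Ring B] [Algebra k B]
  {M : Type*} [AddCommGroup M] [Module k M]
  {N : Type*} [AddCommGroup N] [Module k N]

/-- The endomorphism `m ⊗ n ↦ m b ⊗ n - m ⊗ b n`. -/
def balRel (s : Bᵐᵒᵖ →ₐ[k] Module.End k M) (t : B →ₐ[k] Module.End k N) (b : B) :
    Module.End k (M ⊗[k] N) :=
  (s (MulOpposite.op b)).rTensor N - (t b).lTensor M

@[simp]
lemma balRel_tmul (s : Bᵐᵒᵖ →ₐ[k] Module.End k M) (t : B →ₐ[k] Module.End k N) (b : B)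
    (m : M) (n : N) :
    balRel s t b (m ⊗ₜ n) = s (MulOpposite.op b) m ⊗ₜ n - m ⊗ₜ t b n := rfl

variable {E : Type*} [Ring E] [Algebra k E]

/-- Right multiplication through an algebra map `j : B → E`. -/
def rightAct (j : B →ₐ[k] E) : Bᵐᵒᵖ →ₐ[k] Module.End k E :=
  (Algebra.lsmul k k E : Eᵐᵒᵖ →ₐ[k] Module.End k E).comp (AlgHom.op j)

/-- Left multiplication through an algebra map `j : B → E`. -/
def leftAct (j : B →ₐ[k] E) : B →ₐ[k] Module.End k E :=
  (Algebra.lsmul k k E : E →ₐ[k] Module.End k E).comp j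

@[simp]
lemma rightAct_apply (j : B →ₐ[k] E) (b : B) (e : E) :
    rightAct j (MulOpposite.op b) e = e * j b := rfl

@[simp]
lemma leftAct_apply (j : B →ₐ[k] E) (b : B) (e : E) : leftAct j b e = j b * e := rfl

/-- The action induced on a quotient. -/
lemma exists_descended_action {X Y : Type*} [AddCommGroup X] [Module k X] [AddCommGroup Y]
    [Module k Y] {ι : Type*} {d : ι → Module.End k X} {Φ : X →ₗ[k] Y} (h : Presents d Φ)
    (σ : Bᵐᵒᵖ →ₐ[k] Module.End k X) (hσ : ∀ b i, Φ ∘ₗ σ b ∘ₗ d i = 0) :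
    ∃ τ : Bᵐᵒᵖ →ₐ[k] Module.End k Y, ∀ b x, τ b (Φ x) = Φ (σ b x) := by
  have hex : ∀ b, ∃ g : Y →ₗ[k] Y, g ∘ₗ Φ = Φ ∘ₗ σ b := fun b =>
    h.exists_lift (Φ ∘ₗ σ b) fun i => hσ b i
  choose g hg using hex
  have hg' : ∀ b x, g b (Φ x) = Φ (σ b x) := fun b x => LinearMap.congr_fun (hg b) x
  have hext : ∀ {p q : Module.End k Y}, (∀ x, p (Φ x) = q (Φ x)) → p = q := fun {p q} hpq =>
    LinearMap.ext fun y => by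
      obtain ⟨x, rfl⟩ := h.surjective y
      exact hpq x
  refine ⟨{ toFun := g, map_one' := ?_, map_mul' := ?_, map_zero' := ?_, map_add' := ?_,
            commutes' := ?_ }, hg'⟩
  · exact hext fun x => by simp [hg']
  · exact fun b c => hext fun x => by simp [hg']
  · exact hext fun x => by simp [hg']
  · exact fun b c => hext fun x => by simp [hg']
  · exact fun b => hext fun x => by simp [hg', Algebra.algebraMap_eq_smul_one]

lemma balancedRelations_eq [Module Bᵐᵒᵖ M] [Module B N]
    (s : Bᵐᵒᵖ →ₐ[k] Module.End k M) (t : B →ₐ[k] Module.End k N)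
    (hs : ∀ b m, s b m = b • m) (ht : ∀ b n, t b n = b • n) :
    balancedRelations k B M N = ⨆ b, LinearMap.range (balRel s t b) := by
  apply le_antisymm
  · refine Submodule.span_le.2 ?_
    rintro _ ⟨m, b, n, rfl⟩
    exact Submodule.mem_iSup_of_mem b ⟨m ⊗ₜ n, by simp [hs, ht]⟩
  · refine iSup_le fun b => ?_
    rintro _ ⟨z, rfl⟩
    induction z using TensorProduct.induction_on with
    | zero => simp
    | add x y hx hy => rw [map_add]; exact add_mem hx hy
    | tmul m n => exact Submodule.subset_span ⟨m, b, n, by simp [hs, ht]⟩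

lemma presents_mkQ_balancedRelations [Module Bᵐᵒᵖ M] [Module B N]
    (s : Bᵐᵒᵖ →ₐ[k] Module.End k M) (t : B →ₐ[k] Module.End k N)
    (hs : ∀ b m, s b m = b • m) (ht : ∀ b n, t b n = b • n) :
    Presents (balRel s t) (balancedRelations k B M N).mkQ :=
  ⟨Submodule.mkQ_surjective _, by rw [Submodule.ker_mkQ, balancedRelations_eq s t hs ht]⟩

/-- Balancing over a product of two elements follows from balancing over each of them. -/
lemma balRel_mul (s : Bᵐᵒᵖ →ₐ[k] Module.End k M) (t : B →ₐ[k] Module.End k N) (x y : B) :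
    balRel s t (x * y) = balRel s t y ∘ₗ (s (MulOpposite.op x)).rTensor N +
      balRel s t x ∘ₗ (t y).lTensor M := by
  ext m n
  simp

lemma balRel_add (s : Bᵐᵒᵖ →ₐ[k] Module.End k M) (t : B →ₐ[k] Module.End k N) (x y : B) :
    balRel s t (x + y) = balRel s t x + balRel s t y := by
  ext m n
  simp [TensorProduct.add_tmul, TensorProduct.tmul_add]
  abel

lemma rTensor_comp_balRel {M' : Type*} [AddCommGroup M'] [Module k M']
    {s : Bᵐᵒᵖ →ₐ[k] Module.End k M} {s' : Bᵐᵒᵖ →ₐ[k] Module.End k M'}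
    (t : B →ₐ[k] Module.End k N) {f : M →ₗ[k] M'} (hf : ∀ b m, f (s b m) = s' b (f m)) (b : B) :
    f.rTensor N ∘ₗ balRel s t b = balRel s' t b ∘ₗ f.rTensor N := by
  apply TensorProduct.ext'
  intro m n
  simp [hf]

lemma lTensor_comp_balRel {N' : Type*} [AddCommGroup N'] [Module k N']
    (s : Bᵐᵒᵖ →ₐ[k] Module.End k M) {t : B →ₐ[k] Module.End k N}
    {t' : B →ₐ[k] Module.End k N'} {f : N →ₗ[k] N'} {b : B}
    (hf : ∀ n, f (t b n) = t' b (f n)) :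
    f.lTensor M ∘ₗ balRel s t b = balRel s t' b ∘ₗ f.lTensor M := by
  apply TensorProduct.ext'
  intro m n
  simp [hf]

end Relations

/-- Faithful flatness in terms of arbitrary presentations of the balanced tensor products. -/
lemma LeftFaithfullyFlat.exact_iff {k : Type v} [CommRing k] {B : Type u} [Ring B] [Algebra k B]
    {N : Type u} [AddCommGroup N] [Module k N] [Module B N] (hN : LeftFaithfullyFlat k B N)
    {t : B →ₐ[k] Module.End k N} (ht : ∀ b n, t b n = b • n)
    {M₁ M₂ M₃ : Type u} [AddCommGroup M₁] [AddCommGroup M₂] [AddCommGroup M₃]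
    [Module k M₁] [Module k M₂] [Module k M₃]
    {s₁ : Bᵐᵒᵖ →ₐ[k] Module.End k M₁} {s₂ : Bᵐᵒᵖ →ₐ[k] Module.End k M₂}
    {s₃ : Bᵐᵒᵖ →ₐ[k] Module.End k M₃}
    {f : M₁ →ₗ[k] M₂} {g : M₂ →ₗ[k] M₃}
    (hf : ∀ b m, f (s₁ b m) = s₂ b (f m)) (hg : ∀ b m, g (s₂ b m) = s₃ b (g m))
    {P₁ P₂ P₃ : Type*} [AddCommGroup P₁] [AddCommGroup P₂] [AddCommGroup P₃]
    [Module k P₁] [Module k P₂] [Module k P₃]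
    {Φ₁ : M₁ ⊗[k] N →ₗ[k] P₁} {Φ₂ : M₂ ⊗[k] N →ₗ[k] P₂} {Φ₃ : M₃ ⊗[k] N →ₗ[k] P₃}
    (h₁ : Presents (balRel s₁ t) Φ₁) (h₂ : Presents (balRel s₂ t) Φ₂)
    (h₃ : Presents (balRel s₃ t) Φ₃) {F : P₁ →ₗ[k] P₂} {G : P₂ →ₗ[k] P₃}
    (hF : F ∘ₗ Φ₁ = Φ₂ ∘ₗ f.rTensor N) (hG : G ∘ₗ Φ₂ = Φ₃ ∘ₗ g.rTensor N) :
    Function.Exact f g ↔ Function.Exact F G := by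
  -- The actions are given as algebra maps; they become module structures only here, where the
  -- definition of faithful flatness is applied.
  let i₁ : Module Bᵐᵒᵖ M₁ := Module.compHom M₁ s₁.toRingHom
  let i₂ : Module Bᵐᵒᵖ M₂ := Module.compHom M₂ s₂.toRingHom
  let i₃ : Module Bᵐᵒᵖ M₃ := Module.compHom M₃ s₃.toRingHom
  have e₁ : ∀ b (m : M₁), s₁ b m = b • m := fun _ _ => rfl
  have e₂ : ∀ b (m : M₂), s₂ b m = b • m := fun _ _ => rfl
  have e₃ : ∀ b (m : M₃), s₃ b m = b • m := fun _ _ => rfl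
  have : IsScalarTower k Bᵐᵒᵖ M₁ := ⟨fun c b m => by simp [← e₁]⟩
  have : IsScalarTower k Bᵐᵒᵖ M₂ := ⟨fun c b m => by simp [← e₂]⟩
  have : IsScalarTower k Bᵐᵒᵖ M₃ := ⟨fun c b m => by simp [← e₃]⟩
  let f' : M₁ →ₗ[Bᵐᵒᵖ] M₂ := { f with map_smul' := hf }
  let g' : M₂ →ₗ[Bᵐᵒᵖ] M₃ := { g with map_smul' := hg }
  have key := hN M₁ M₂ M₃ f' g'
  have q₁ := presents_mkQ_balancedRelations s₁ t e₁ ht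
  have q₂ := presents_mkQ_balancedRelations s₂ t e₂ ht
  have q₃ := presents_mkQ_balancedRelations s₃ t e₃ ht
  refine Iff.trans key (exact_iff_of_ker_eq (f := f.rTensor N) (g := g.rTensor N)
    q₁.surjective q₂.surjective h₁.surjective h₂.surjective (q₂.ker_eq.trans h₂.ker_eq.symm)
    (q₃.ker_eq.trans h₃.ker_eq.symm) ?_ ?_ hF hG)
  · rfl
  · rfl

/-- The functor `- ⊗_B N` preserves injectivity. -/
lemma LeftFaithfullyFlat.injective {k : Type v} [CommRing k] {B : Type u} [Ring B] [Algebra k B]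
    {N : Type u} [AddCommGroup N] [Module k N] [Module B N] (hN : LeftFaithfullyFlat k B N)
    {t : B →ₐ[k] Module.End k N} (ht : ∀ b n, t b n = b • n)
    {M₁ M₂ : Type u} [AddCommGroup M₁] [AddCommGroup M₂] [Module k M₁] [Module k M₂]
    {s₁ : Bᵐᵒᵖ →ₐ[k] Module.End k M₁} {s₂ : Bᵐᵒᵖ →ₐ[k] Module.End k M₂}
    {f : M₁ →ₗ[k] M₂} (hf : ∀ b m, f (s₁ b m) = s₂ b (f m))
    {P₁ P₂ : Type*} [AddCommGroup P₁] [AddCommGroup P₂] [Module k P₁] [Module k P₂]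
    {Φ₁ : M₁ ⊗[k] N →ₗ[k] P₁} {Φ₂ : M₂ ⊗[k] N →ₗ[k] P₂}
    (h₁ : Presents (balRel s₁ t) Φ₁) (h₂ : Presents (balRel s₂ t) Φ₂)
    {F : P₁ →ₗ[k] P₂} (hF : F ∘ₗ Φ₁ = Φ₂ ∘ₗ f.rTensor N) (hinj : Function.Injective f) :
    Function.Injective F :=
  (LinearMap.exact_zero_iff_injective P₁ F).1 <|
    -- Injectivity is exactness of a sequence starting with a zero map; `M₁` itself serves as
    -- source, so no zero module is needed.
    (hN.exact_iff ht (f := (0 : M₁ →ₗ[k] M₁)) (s₁ := s₁) (by simp) hf h₁ h₁ h₂ (F := 0)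
      (by simp) hF).1 ((LinearMap.exact_zero_iff_injective M₁ f).2 hinj)

/-- The functor `- ⊗_B N` reflects bijectivity. -/
lemma LeftFaithfullyFlat.bijective {k : Type v} [CommRing k] {B : Type u} [Ring B] [Algebra k B]
    {N : Type u} [AddCommGroup N] [Module k N] [Module B N] (hN : LeftFaithfullyFlat k B N)
    {t : B →ₐ[k] Module.End k N} (ht : ∀ b n, t b n = b • n)
    {M₁ M₂ : Type u} [AddCommGroup M₁] [AddCommGroup M₂] [Module k M₁] [Module k M₂]
    {s₁ : Bᵐᵒᵖ →ₐ[k] Module.End k M₁} {s₂ : Bᵐᵒᵖ →ₐ[k] Module.End k M₂}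
    {f : M₁ →ₗ[k] M₂} (hf : ∀ b m, f (s₁ b m) = s₂ b (f m))
    {P₁ P₂ : Type*} [AddCommGroup P₁] [AddCommGroup P₂] [Module k P₁] [Module k P₂]
    {Φ₁ : M₁ ⊗[k] N →ₗ[k] P₁} {Φ₂ : M₂ ⊗[k] N →ₗ[k] P₂}
    (h₁ : Presents (balRel s₁ t) Φ₁) (h₂ : Presents (balRel s₂ t) Φ₂)
    {F : P₁ →ₗ[k] P₂} (hF : F ∘ₗ Φ₁ = Φ₂ ∘ₗ f.rTensor N) (hbij : Function.Bijective F) :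
    Function.Bijective f := by
  constructor
  · have := (hN.exact_iff ht (f := (0 : M₁ →ₗ[k] M₁)) (s₁ := s₁) (by simp) hf h₁ h₁ h₂ (F := 0)
      (by simp) hF).2 ((LinearMap.exact_zero_iff_injective P₁ F).2 hbij.1)
    exact (LinearMap.exact_zero_iff_injective M₁ f).1 this
  · have := (hN.exact_iff ht (g := (0 : M₂ →ₗ[k] M₂)) (s₃ := s₂) hf (by simp) h₁ h₂ h₂ (G := 0)
      hF (by simp)).2 ((LinearMap.exact_zero_iff_surjective P₂ F).2 hbij.2)
    exact (LinearMap.exact_zero_iff_surjective M₂ f).1 this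

/-! ### The Galois isomorphism after extension of scalars. -/

section GaloisMap

variable {k : Type*} {H : Type*} {A : Type*} {E : Type*} [CommRing k] [Ring H] [Bialgebra k H]
  [Ring A] [Algebra k A] [RightComoduleAlgebra k H A] [Ring E] [Algebra k E]

variable (H) in
/-- The map `E ⊗ A → E ⊗ H`, `x ⊗ a ↦ x j(a₀) ⊗ a₁`. -/
def galoisMap (j : A →ₐ[k] E) : E ⊗[k] A →ₗ[k] E ⊗[k] H :=
  LinearMap.mul' k (E ⊗[k] H) ∘ₗ
    TensorProduct.map (Algebra.TensorProduct.includeLeft (R := k) (S := k) (A := E)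
      (B := H)).toLinearMap
      ((Algebra.TensorProduct.map j (AlgHom.id k H)).comp (coaction k H A)).toLinearMap

@[simp]
lemma galoisMap_tmul (j : A →ₐ[k] E) (x : E) (a : A) :
    galoisMap H j (x ⊗ₜ a) =
      (x ⊗ₜ 1) * Algebra.TensorProduct.map j (AlgHom.id k H) (coaction k H A a) := rfl

lemma presents_canAux (hcan : Function.Bijective (can k H A)) :
    Presents (balRel (rightAct (coinvariants k H A).val) (leftAct (coinvariants k H A).val))
      (canAux k H A) :=
  (presents_mkQ_balancedRelations (rightAct (coinvariants k H A).val)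
    (leftAct (coinvariants k H A).val) (fun _ _ => rfl) (fun _ _ => rfl)).equiv_comp
    (LinearEquiv.ofBijective (can k H A) hcan)

/-- The map `E ⊗ (A ⊗ V) → E ⊗ V`, `x ⊗ (a ⊗ v) ↦ x j(a) ⊗ v`. -/
def actMap (j : A →ₐ[k] E) (V : Type*) [AddCommGroup V] [Module k V] :
    E ⊗[k] (A ⊗[k] V) →ₗ[k] E ⊗[k] V :=
  (LinearMap.mul' k E ∘ₗ j.toLinearMap.lTensor E).rTensor V ∘ₗ
    (TensorProduct.assoc k E A V).symm.toLinearMap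

@[simp]
lemma actMap_tmul (j : A →ₐ[k] E) (V : Type*) [AddCommGroup V] [Module k V] (x : E) (a : A)
    (v : V) : actMap j V (x ⊗ₜ (a ⊗ₜ v)) = (x * j a) ⊗ₜ v := rfl

lemma actMap_surjective (j : A →ₐ[k] E) (V : Type*) [AddCommGroup V] [Module k V] :
    Function.Surjective (actMap j V) := by
  have : actMap j V ∘ₗ (TensorProduct.mk k A V 1).lTensor E = LinearMap.id := by
    ext; simp
  exact fun y => ⟨_, LinearMap.congr_fun this y⟩

/-- This is `E ⊗_A (A ⊗ V) ≅ E ⊗ V`: modulo the relations, every tensor can be moved into `E ⊗ (1 ⊗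
V)`. -/
lemma presents_actMap (j : A →ₐ[k] E) (V : Type*) [Ring V] [Algebra k V] :
    Presents (balRel (rightAct j)
      (leftAct (Algebra.TensorProduct.includeLeft : A →ₐ[k] A ⊗[k] V))) (actMap j V) where
  surjective := actMap_surjective j V
  ker_eq := by
    apply le_antisymm
    · intro z hz
      have key : ∀ z, z - (TensorProduct.mk k A V 1).lTensor E (actMap j V z) ∈
          ⨆ a, LinearMap.range (balRel (rightAct j)
            (leftAct (Algebra.TensorProduct.includeLeft : A →ₐ[k] A ⊗[k] V)) a) := by
        intro z
        induction z using TensorProduct.induction_on with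
        | zero => simp
        | add x y hx hy => rw [map_add, map_add, add_sub_add_comm]; exact add_mem hx hy
        | tmul x w =>
          induction w using TensorProduct.induction_on with
          | zero => simp
          | add v w hv hw =>
            rw [TensorProduct.tmul_add, map_add, map_add, add_sub_add_comm]
            exact add_mem hv hw
          | tmul a v =>
            refine Submodule.mem_iSup_of_mem a ⟨-(x ⊗ₜ (1 ⊗ₜ v)), ?_⟩
            simp
      simpa [LinearMap.mem_ker.1 hz] using key z
    · refine iSup_le fun a => ?_
      rw [LinearMap.range_le_ker_iff]
      ext x a' v
      simp [mul_assoc]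

/-- If `A` is `H`-Galois over `B`, then so is `E ⊗_B A ≅ E ⊗ H` for every algebra map `A → E`. -/
lemma presents_galoisMap (hcan : Function.Bijective (can k H A)) (j : A →ₐ[k] E) :
    Presents (balRel (rightAct (j.comp (coinvariants k H A).val))
      (leftAct (coinvariants k H A).val)) (galoisMap H j) := by
  -- Divide `E ⊗ (A ⊗ A)` by the balancing over `B` and the balancing over `A` in both orders.
  -- Taking `B` first gives `E ⊗ (A ⊗ H)` and then `E ⊗ H`; taking `A` first leaves `E ⊗ A` with its
  -- balancing over `B`.
  have h1 := ((presents_canAux hcan).lTensor E).comp (presents_actMap j H)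
    (balRel (rightAct j) (leftAct (Algebra.TensorProduct.includeLeft : A →ₐ[k] A ⊗[k] A)))
    (fun a => by
      ext x b c
      simp [canAux_tmul, ← mul_assoc])
  have h2 : actMap j H ∘ₗ (canAux k H A).lTensor E = galoisMap H j ∘ₗ actMap j A := by
    ext x a b
    simp only [LinearMap.comp_apply, TensorProduct.AlgebraTensorModule.curry_apply,
      TensorProduct.curry_apply, LinearMap.restrictScalars_self, LinearMap.lTensor_tmul,
      actMap_tmul, galoisMap_tmul, canAux_tmul]
    induction coaction k H A b using TensorProduct.induction_on with
    | zero => simp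
    | add x y hx hy => simp only [mul_add, map_add, TensorProduct.tmul_add, hx, hy]
    | tmul c h => simp [mul_assoc]
  rw [h2] at h1
  refine Presents.of_comp (actMap_surjective j A) (h1.congr_rel (e := Sum.elim _ _) ?_)
    (d := balRel (rightAct j) (leftAct (Algebra.TensorProduct.includeLeft : A →ₐ[k] A ⊗[k] A)))
    (e' := fun b => (balRel (rightAct (coinvariants k H A).val)
      (leftAct (coinvariants k H A).val) b).lTensor E) ?_ ?_
  · simp only [iSup_sum, Sum.elim_inl, Sum.elim_inr]
    exact sup_comm _ _
  · intro a
    ext x b c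
    simp [mul_assoc]
  · intro b
    ext x a c
    simp [mul_assoc, TensorProduct.tmul_sub]

end GaloisMap

/-! ### Two commuting coactions on one algebra. -/

section Twist

variable {k : Type*} {H : Type*} {C : Type*} [CommRing k] [Ring H] [HopfAlgebra k H]
  [Ring C] [Algebra k C]

variable (k H C) in
/-- The map `id ⊗ Δ : C ⊗ H → (C ⊗ H) ⊗ H`. -/
def comulRight : C ⊗[k] H →ₐ[k] (C ⊗[k] H) ⊗[k] H :=
  (Algebra.TensorProduct.assoc k k k C H H).symm.toAlgHom.comp
    (Algebra.TensorProduct.map (AlgHom.id k C) (Bialgebra.comulAlgHom k H))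

lemma comulRight_tmul (c : C) (h : H) : comulRight k H C (c ⊗ₜ h) =
    (TensorProduct.assoc k C H H).symm (c ⊗ₜ Coalgebra.comul (R := k) h) := rfl

lemma comulRight_eq (x : C ⊗[k] H) : comulRight k H C x =
    (TensorProduct.assoc k C H H).symm ((Coalgebra.comul (R := k)).lTensor C x) := rfl

/-- The map `δ ⊗ id : C ⊗ H → (C ⊗ H) ⊗ H`. -/
def coactH (δ : C →ₐ[k] C ⊗[k] H) : C ⊗[k] H →ₐ[k] (C ⊗[k] H) ⊗[k] H :=
  Algebra.TensorProduct.map δ (AlgHom.id k H)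

@[simp]
lemma coactH_tmul (δ : C →ₐ[k] C ⊗[k] H) (c : C) (h : H) : coactH δ (c ⊗ₜ h) = δ c ⊗ₜ h := rfl

variable (k H C) in
/-- The map `id ⊗ ε : C ⊗ H → C`. -/
def evalCounit : C ⊗[k] H →ₗ[k] C :=
  (TensorProduct.rid k C).toLinearMap ∘ₗ (Coalgebra.counit (R := k)).lTensor C

@[simp]
lemma evalCounit_tmul (c : C) (h : H) :
    evalCounit k H C (c ⊗ₜ h) = Coalgebra.counit (R := k) h • c := by
  simp [evalCounit]

/-- The map `C ⊗ H → C ⊗ H`, `c ⊗ h ↦ c₀ ⊗ c₁ h`. -/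
def twist (δ : C →ₐ[k] C ⊗[k] H) : C ⊗[k] H →ₗ[k] C ⊗[k] H :=
  LinearMap.mul' k (C ⊗[k] H) ∘ₗ TensorProduct.map δ.toLinearMap
    (Algebra.TensorProduct.includeRight (R := k) (A := C) (B := H)).toLinearMap

@[simp]
lemma twist_tmul (δ : C →ₐ[k] C ⊗[k] H) (c : C) (h : H) :
    twist δ (c ⊗ₜ h) = δ c * (1 ⊗ₜ h) := rfl

/-- The map `C ⊗ H → C ⊗ H`, `c ⊗ h ↦ c₀ ⊗ S(c₁) h`. -/
def untwist (δ : C →ₐ[k] C ⊗[k] H) : C ⊗[k] H →ₗ[k] C ⊗[k] H :=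
  (LinearMap.mul' k H ∘ₗ (HopfAlgebra.antipode k).rTensor H).lTensor C ∘ₗ
    (TensorProduct.assoc k C H H).toLinearMap ∘ₗ δ.toLinearMap.rTensor H

variable {δ : C →ₐ[k] C ⊗[k] H}

/-- Coassociativity and the antipode: `c₀ ⊗ S(c₁)c₂h = c₀ ⊗ ε(c₁)h = c ⊗ h`. The other composite
uses `c₁S(c₂)` instead. -/
lemma untwist_twist (h₁ : ∀ c, coactH δ (δ c) = comulRight k H C (δ c))
    (h₂ : ∀ c, (Coalgebra.counit (R := k) (A := H)).lTensor C (δ c) = c ⊗ₜ 1) (z : C ⊗[k] H) :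
    untwist δ (twist δ z) = z := by
  induction z using TensorProduct.induction_on with
  | zero => simp
  | add x y hx hy => simp only [map_add, hx, hy]
  | tmul c h =>
    have key : ∀ t : C ⊗[k] H, untwist δ (t * (1 ⊗ₜ h)) =
        (LinearMap.mulRight k h ∘ₗ LinearMap.mul' k H ∘ₗ
          (HopfAlgebra.antipode k).rTensor H).lTensor C
          (TensorProduct.assoc k C H H (coactH δ t)) := by
      intro t
      induction t using TensorProduct.induction_on with
      | zero => simp
      | add x y hx hy => simp only [add_mul, map_add, hx, hy]
      | tmul c' g =>
        simp only [untwist, Algebra.TensorProduct.tmul_mul_tmul, mul_one, LinearMap.comp_apply,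
          LinearMap.rTensor_tmul, AlgHom.toLinearMap_apply, coactH_tmul]
        induction δ c' using TensorProduct.induction_on with
        | zero => simp
        | add x y hx hy => simp only [TensorProduct.add_tmul, map_add, hx, hy]
        | tmul c'' g' => simp [mul_assoc]
    rw [twist_tmul, key, h₁, comulRight_eq, LinearEquiv.apply_symm_apply,
      ← LinearMap.lTensor_comp_apply]
    have e : (LinearMap.mulRight k h ∘ₗ LinearMap.mul' k H ∘ₗ
        (HopfAlgebra.antipode k).rTensor H) ∘ₗ Coalgebra.comul =
        LinearMap.toSpanSingleton k H h ∘ₗ Coalgebra.counit (R := k) := by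
      ext g
      simp [HopfAlgebra.mul_antipode_rTensor_comul_apply, Algebra.algebraMap_eq_smul_one]
    rw [e, LinearMap.lTensor_comp_apply, h₂]
    simp

lemma twist_untwist (h₁ : ∀ c, coactH δ (δ c) = comulRight k H C (δ c))
    (h₂ : ∀ c, (Coalgebra.counit (R := k) (A := H)).lTensor C (δ c) = c ⊗ₜ 1) (z : C ⊗[k] H) :
    twist δ (untwist δ z) = z := by
  induction z using TensorProduct.induction_on with
  | zero => simp
  | add x y hx hy => simp only [map_add, hx, hy]
  | tmul c h =>
    have key : ∀ t : C ⊗[k] H, twist δ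
        ((LinearMap.mul' k H ∘ₗ (HopfAlgebra.antipode k).rTensor H).lTensor C
          (TensorProduct.assoc k C H H (t ⊗ₜ h))) =
        (LinearMap.mulRight k h ∘ₗ LinearMap.mul' k H ∘ₗ
          (HopfAlgebra.antipode k).lTensor H).lTensor C
          (TensorProduct.assoc k C H H (coactH δ t)) := by
      intro t
      induction t using TensorProduct.induction_on with
      | zero => simp
      | add x y hx hy => simp only [TensorProduct.add_tmul, map_add, hx, hy]
      | tmul c' g =>
        simp only [coactH_tmul, TensorProduct.assoc_tmul, LinearMap.lTensor_tmul,
          LinearMap.comp_apply, LinearMap.rTensor_tmul, twist_tmul, LinearMap.mul'_apply]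
        induction δ c' using TensorProduct.induction_on with
        | zero => simp
        | add x y hx hy => simp only [TensorProduct.add_tmul, add_mul, map_add, hx, hy]
        | tmul c'' g' => simp [mul_assoc]
    have h0 : untwist δ (c ⊗ₜ h) =
        (LinearMap.mul' k H ∘ₗ (HopfAlgebra.antipode k).rTensor H).lTensor C
          (TensorProduct.assoc k C H H (δ c ⊗ₜ h)) := rfl
    rw [h0, key, h₁, comulRight_eq, LinearEquiv.apply_symm_apply,
      ← LinearMap.lTensor_comp_apply]
    have e : (LinearMap.mulRight k h ∘ₗ LinearMap.mul' k H ∘ₗ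
        (HopfAlgebra.antipode k).lTensor H) ∘ₗ Coalgebra.comul =
        LinearMap.toSpanSingleton k H h ∘ₗ Coalgebra.counit (R := k) := by
      ext g
      simp [HopfAlgebra.mul_antipode_lTensor_comul_apply, Algebra.algebraMap_eq_smul_one]
    rw [e, LinearMap.lTensor_comp_apply, h₂]
    simp

/-- `twist δ`, acting on the first and the last factor of `(C ⊗ H) ⊗ H`. -/
def outerTwist (δ : C →ₐ[k] C ⊗[k] H) : (C ⊗[k] H) ⊗[k] H →ₗ[k] (C ⊗[k] H) ⊗[k] H :=
  (flipHH k H C).toLinearMap ∘ₗ (twist δ).rTensor H ∘ₗ (flipHH k H C).toLinearMap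

lemma flipHH_flipHH (z : (C ⊗[k] H) ⊗[k] H) : flipHH k H C (flipHH k H C z) = z := by
  have : (flipHH k H C).toLinearMap ∘ₗ (flipHH k H C).toLinearMap = LinearMap.id := by
    ext; simp
  exact LinearMap.congr_fun this z

lemma outerTwist_injective (h₁ : ∀ c, coactH δ (δ c) = comulRight k H C (δ c))
    (h₂ : ∀ c, (Coalgebra.counit (R := k) (A := H)).lTensor C (δ c) = c ⊗ₜ 1) :
    Function.Injective (outerTwist δ) := by
  have hinj : Function.Injective ((twist δ).rTensor H) := by
    have : (untwist δ).rTensor H ∘ₗ (twist δ).rTensor H = LinearMap.id := by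
      rw [← LinearMap.rTensor_comp, show untwist δ ∘ₗ twist δ = LinearMap.id from
        LinearMap.ext (untwist_twist h₁ h₂), LinearMap.rTensor_id]
    exact Function.LeftInverse.injective (g := (untwist δ).rTensor H)
      (LinearMap.congr_fun this)
  exact (flipHH k H C).injective.comp (hinj.comp (flipHH k H C).injective)

/-- On elements `outerTwist` sends `c ⊗ p ⊗ q` to `c₀ ⊗ p ⊗ c₁q`, so it commutes with right
multiplication by the two factors in `H`. -/
lemma outerTwist_mul (u : C ⊗[k] H) (w : H ⊗[k] H) :
    outerTwist δ ((u ⊗ₜ 1) * (TensorProduct.assoc k C H H).symm (1 ⊗ₜ w)) =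
      flipHH k H C (coactH δ u) * (TensorProduct.assoc k C H H).symm (1 ⊗ₜ w) := by
  induction w using TensorProduct.induction_on with
  | zero => simp
  | add x y hx hy => simp only [TensorProduct.tmul_add, map_add, mul_add, hx, hy]
  | tmul p q =>
    induction u using TensorProduct.induction_on with
    | zero => simp
    | add x y hx hy => simp only [TensorProduct.add_tmul, map_add, add_mul, hx, hy]
    | tmul c g =>
      simp only [outerTwist, TensorProduct.assoc_symm_tmul, Algebra.TensorProduct.tmul_mul_tmul,
        mul_one, one_mul, LinearMap.comp_apply, LinearEquiv.coe_coe, TensorProduct.rightComm_tmul,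
        LinearMap.rTensor_tmul, twist_tmul, coactH_tmul]
      induction δ c using TensorProduct.induction_on with
      | zero => simp
      | add x y hx hy => simp only [TensorProduct.add_tmul, map_add, add_mul, hx, hy]
      | tmul c' g' => simp

/-- The map `C ⊗ H → (C ⊗ H) ⊗ H`, `c ⊗ h ↦ c₀ ⊗ c₁ h₁ ⊗ h₂`. -/
def twistComul (δ : C →ₐ[k] C ⊗[k] H) : C ⊗[k] H →ₗ[k] (C ⊗[k] H) ⊗[k] H :=
  LinearMap.mul' k _ ∘ₗ TensorProduct.map
    ((Algebra.TensorProduct.includeLeft (R := k) (S := k) (A := C ⊗[k] H)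
      (B := H)).comp δ).toLinearMap
    ((comulRight k H C).comp
      (Algebra.TensorProduct.includeRight (R := k) (A := C) (B := H))).toLinearMap

lemma twistComul_tmul (c : C) (h : H) :
    twistComul δ (c ⊗ₜ h) = (δ c ⊗ₜ 1) * comulRight k H C (1 ⊗ₜ h) := rfl

lemma flipHH_comulRight [Coalgebra.IsCocomm k H] (x : C ⊗[k] H) :
    flipHH k H C (comulRight k H C x) = comulRight k H C x := by
  induction x using TensorProduct.induction_on with
  | zero => simp
  | add x y hx hy => simp only [map_add, hx, hy]
  | tmul c h =>
    have : ∀ w : H ⊗[k] H, flipHH k H C ((TensorProduct.assoc k C H H).symm (c ⊗ₜ w)) =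
        (TensorProduct.assoc k C H H).symm (c ⊗ₜ TensorProduct.comm k H H w) := by
      intro w
      induction w using TensorProduct.induction_on with
      | zero => simp
      | add x y hx hy => simp only [TensorProduct.tmul_add, map_add, hx, hy]
      | tmul p q => simp
    rw [comulRight_tmul, this, Coalgebra.comm_comul]

/-- The left side is `c₀ ⊗ c₂h₁ ⊗ c₁h₂` and the right side `c₀ ⊗ c₁h₁ ⊗ c₂h₂`; cocommutativity
exchanges `c₁` and `c₂`. -/
lemma outerTwist_twistComul [Coalgebra.IsCocomm k H]
    (h₁ : ∀ c, coactH δ (δ c) = comulRight k H C (δ c)) (z : C ⊗[k] H) :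
    outerTwist δ (twistComul δ z) = comulRight k H C (twist δ z) := by
  induction z using TensorProduct.induction_on with
  | zero => simp
  | add x y hx hy => simp only [map_add, hx, hy]
  | tmul c h =>
    rw [twistComul_tmul, comulRight_tmul, outerTwist_mul, h₁, flipHH_comulRight, twist_tmul,
      map_mul, ← comulRight_tmul]

lemma outerTwist_coactH {δ' : C →ₐ[k] C ⊗[k] H}
    (hc : ∀ c, coactH δ (δ' c) = flipHH k H C (coactH δ' (δ c))) (z : C ⊗[k] H) :
    outerTwist δ (coactH δ' z) = coactH δ' (twist δ z) := by
  induction z using TensorProduct.induction_on with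
  | zero => simp
  | add x y hx hy => simp only [map_add, hx, hy]
  | tmul c h =>
    have e : coactH δ' (c ⊗ₜ h) = (δ' c ⊗ₜ[k] (1 : H)) *
        (TensorProduct.assoc k C H H).symm (1 ⊗ₜ (1 ⊗ₜ h)) := by
      rw [TensorProduct.assoc_symm_tmul, Algebra.TensorProduct.tmul_mul_tmul,
        ← Algebra.TensorProduct.one_def, mul_one, one_mul, coactH_tmul]
    rw [e, outerTwist_mul, hc, flipHH_flipHH, twist_tmul, map_mul,
      TensorProduct.assoc_symm_tmul, coactH_tmul, map_one, Algebra.TensorProduct.one_def]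

lemma evalCounit_twistComul (z : C ⊗[k] H) :
    evalCounit k H (C ⊗[k] H) (twistComul δ z) = twist δ z := by
  induction z using TensorProduct.induction_on with
  | zero => simp
  | add x y hx hy => simp only [map_add, hx, hy]
  | tmul c h =>
    have key : ∀ w : H ⊗[k] H, evalCounit k H (C ⊗[k] H)
        ((δ c ⊗ₜ 1) * (TensorProduct.assoc k C H H).symm (1 ⊗ₜ w)) =
        δ c * (1 ⊗ₜ TensorProduct.rid k H ((Coalgebra.counit (R := k)).lTensor H w)) := by
      intro w
      induction w using TensorProduct.induction_on with
      | zero => simp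
      | add x y hx hy => simp only [TensorProduct.tmul_add, map_add, mul_add, hx, hy]
      | tmul p q => simp
    rw [twistComul_tmul, comulRight_tmul, key, Coalgebra.lTensor_counit_comul, twist_tmul]
    simp

lemma evalCounit_coactH (z : C ⊗[k] H) :
    evalCounit k H (C ⊗[k] H) (coactH δ z) = δ (evalCounit k H C z) := by
  induction z using TensorProduct.induction_on with
  | zero => simp
  | add x y hx hy => simp only [map_add, hx, hy]
  | tmul c h => simp

variable {δ' : C →ₐ[k] C ⊗[k] H}

/-- Applying `ε` to the last factor of `hz` gives `twist δ z = δ' (evalCounit k H C z)`, and `twist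
δ` is injective. -/
lemma eq_zero_of_evalCounit_eq_zero (h₁ : ∀ c, coactH δ (δ c) = comulRight k H C (δ c))
    (h₂ : ∀ c, (Coalgebra.counit (R := k) (A := H)).lTensor C (δ c) = c ⊗ₜ 1)
    {z : C ⊗[k] H} (hz : twistComul δ z = coactH δ' z) (h0 : evalCounit k H C z = 0) : z = 0 := by
  have := congrArg (evalCounit k H (C ⊗[k] H)) hz
  rw [evalCounit_twistComul, evalCounit_coactH, h0, map_zero] at this
  rw [← untwist_twist h₁ h₂ z, this, map_zero]

lemma exists_evalCounit_eq [Coalgebra.IsCocomm k H]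
    (h₁ : ∀ c, coactH δ (δ c) = comulRight k H C (δ c))
    (h₂ : ∀ c, (Coalgebra.counit (R := k) (A := H)).lTensor C (δ c) = c ⊗ₜ 1)
    (h₁' : ∀ c, coactH δ' (δ' c) = comulRight k H C (δ' c))
    (h₂' : ∀ c, (Coalgebra.counit (R := k) (A := H)).lTensor C (δ' c) = c ⊗ₜ 1)
    (hc : ∀ c, coactH δ (δ' c) = flipHH k H C (coactH δ' (δ c))) (x : C) :
    ∃ z, twistComul δ z = coactH δ' z ∧ evalCounit k H C z = x := by
  -- The witness is forced, since any solution satisfies `twist δ z = δ' x`. Under the injective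
  -- `outerTwist δ` the required equation becomes coassociativity of `δ'` at `x`.
  have hz : twistComul δ (untwist δ (δ' x)) = coactH δ' (untwist δ (δ' x)) := by
    apply outerTwist_injective h₁ h₂
    rw [outerTwist_twistComul h₁, outerTwist_coactH hc, twist_untwist h₁ h₂, h₁']
  refine ⟨_, hz, ?_⟩
  have h := congrArg (evalCounit k H (C ⊗[k] H)) hz
  rw [evalCounit_twistComul, evalCounit_coactH, twist_untwist h₁ h₂] at h
  have hinj : ∀ c, evalCounit k H C (δ' c) = c := fun c => by simp [evalCounit, h₂']
  -- By `h`, the counit value and `x` have the same image under `δ'`, which the counit axiom makes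
  -- injective.
  rw [← hinj (evalCounit k H C (untwist δ (δ' x))), ← h, hinj]

end Twist

/-! ### The two coactions on `A ⊗ A'`. -/

section Coactions

variable {k : Type*} {H : Type*} {A A' : Type*} [CommRing k] [Ring H] [Bialgebra k H]
  [Ring A] [Algebra k A] [RightComoduleAlgebra k H A]
  [Ring A'] [Algebra k A'] [RightComoduleAlgebra k H A']

/-- Swapping the factors exchanges the two coactions, so the comodule axioms are needed for only one
of them. -/
lemma coactLeft_eq_coactRight_comm (x : A ⊗[k] A') :
    coactLeft k H A A' x = (TensorProduct.comm k A' A).toLinearMap.rTensor H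
      (coactRight k H A' A (TensorProduct.comm k A A' x)) := by
  induction x using TensorProduct.induction_on with
  | zero => simp
  | add x y hx hy => simp only [map_add, hx, hy]
  | tmul a a' =>
    rw [coactLeft_tmul, TensorProduct.comm_tmul, coactRight_tmul]
    induction coaction k H A a using TensorProduct.induction_on with
    | zero => simp
    | add x y hx hy => simp only [TensorProduct.add_tmul, TensorProduct.tmul_add, map_add, hx, hy]
    | tmul c h => simp

lemma coactLeft_counit (x : A ⊗[k] A') :
    (Coalgebra.counit (R := k) (A := H)).lTensor (A ⊗[k] A') (coactLeft k H A A' x) =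
      x ⊗ₜ[k] (1 : k) := by
  rw [coactLeft_eq_coactRight_comm, ← LinearMap.comp_apply, LinearMap.lTensor_comp_rTensor,
    ← LinearMap.rTensor_comp_lTensor, LinearMap.comp_apply, coactRight_counit]
  simp

lemma coactLeft_one_tmul {a' : A'} : coactLeft k H A A' (1 ⊗ₜ a') = (1 ⊗ₜ a') ⊗ₜ 1 := by
  rw [coactLeft_tmul, map_one, Algebra.TensorProduct.one_def, TensorProduct.rightComm_tmul]

lemma coactRight_one_tmul (a' : A') : coactRight k H A A' (1 ⊗ₜ a') =
    Algebra.TensorProduct.map (Algebra.TensorProduct.includeRight : A' →ₐ[k] A ⊗[k] A')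
      (AlgHom.id k H) (coaction k H A' a') := by
  rw [coactRight_tmul]
  induction coaction k H A' a' using TensorProduct.induction_on with
  | zero => simp
  | add x y hx hy => simp only [TensorProduct.tmul_add, map_add, hx, hy]
  | tmul c h => simp

lemma coactLeft_tmul_one (a : A) : coactLeft k H A A' (a ⊗ₜ 1) =
    Algebra.TensorProduct.map (Algebra.TensorProduct.includeLeft : A →ₐ[k] A ⊗[k] A')
      (AlgHom.id k H) (coaction k H A a) := by
  rw [coactLeft_tmul]
  induction coaction k H A a using TensorProduct.induction_on with
  | zero => simp
  | add x y hx hy => simp only [TensorProduct.add_tmul, map_add, hx, hy]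
  | tmul c h => simp

end Coactions

/-! ### Compatibility of the coactions with the twist maps. -/

section HopfCoactions

variable {k : Type*} {H : Type*} {A A' : Type*} [CommRing k] [Ring H] [HopfAlgebra k H]
  [Ring A] [Algebra k A] [RightComoduleAlgebra k H A]
  [Ring A'] [Algebra k A'] [RightComoduleAlgebra k H A']

lemma coactH_coactRight (x : A ⊗[k] A') :
    coactH (coactRight k H A A') (coactRight k H A A' x) =
      comulRight k H _ (coactRight k H A A' x) := by
  rw [comulRight_eq, ← coactRight_coassoc, LinearEquiv.symm_apply_apply]
  rfl

lemma coactH_coactLeft (x : A ⊗[k] A') :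
    coactH (coactLeft k H A A') (coactLeft k H A A' x) =
      comulRight k H _ (coactLeft k H A A' x) := by
  have e1 : ∀ t : (A' ⊗[k] A) ⊗[k] H, coactH (coactLeft k H A A')
      ((TensorProduct.comm k A' A).toLinearMap.rTensor H t) =
      ((TensorProduct.comm k A' A).toLinearMap.rTensor H).rTensor H
        (coactH (coactRight k H A' A) t) := by
    intro t
    induction t using TensorProduct.induction_on with
    | zero => simp
    | add x y hx hy => simp only [map_add, hx, hy]
    | tmul c h =>
      rw [LinearMap.rTensor_tmul, coactH_tmul, coactLeft_eq_coactRight_comm, coactH_tmul,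
        LinearMap.rTensor_tmul]
      congr 4
      exact (TensorProduct.comm k A' A).symm_apply_apply c
  have e2 : ∀ t : (A' ⊗[k] A) ⊗[k] H, comulRight k H _
      ((TensorProduct.comm k A' A).toLinearMap.rTensor H t) =
      ((TensorProduct.comm k A' A).toLinearMap.rTensor H).rTensor H
        (comulRight k H _ t) := by
    intro t
    induction t using TensorProduct.induction_on with
    | zero => simp
    | add x y hx hy => simp only [map_add, hx, hy]
    | tmul c h =>
      rw [LinearMap.rTensor_tmul, comulRight_tmul, comulRight_tmul]
      induction Coalgebra.comul (R := k) h using TensorProduct.induction_on with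
      | zero => simp
      | add x y hx hy => simp only [TensorProduct.tmul_add, map_add, hx, hy]
      | tmul p q => simp
  rw [coactLeft_eq_coactRight_comm, e1, e2, coactH_coactRight]

lemma coactH_coactLeft_coactRight (x : A ⊗[k] A') :
    coactH (coactLeft k H A A') (coactRight k H A A' x) =
      flipHH k H (A ⊗[k] A') (coactH (coactRight k H A A') (coactLeft k H A A' x)) :=
  coactLeft_coactRight x

lemma twistComul_mul {C : Type*} [Ring C] [Algebra k C] (δ : C →ₐ[k] C ⊗[k] H) (c : C)
    (t : C ⊗[k] H) : twistComul δ ((c ⊗ₜ 1) * t) = (δ c ⊗ₜ 1) * twistComul δ t := by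
  induction t using TensorProduct.induction_on with
  | zero => simp
  | add x y hx hy => simp only [mul_add, map_add, hx, hy]
  | tmul c' h =>
    rw [Algebra.TensorProduct.tmul_mul_tmul, one_mul, twistComul_tmul, twistComul_tmul, map_mul,
      ← mul_assoc, Algebra.TensorProduct.tmul_mul_tmul, mul_one]

/-- The coaction of `A` fixes `1 ⊗ A'`, so on these elements the twist disappears and only the
comultiplication of the last factor remains. -/
lemma twistComul_coactLeft_one_tmul (a' : A') :
    twistComul (coactLeft k H A A') (coactRight k H A A' (1 ⊗ₜ a')) =
      comulRight k H _ (coactRight k H A A' (1 ⊗ₜ a')) := by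
  rw [coactRight_one_tmul]
  induction coaction k H A' a' using TensorProduct.induction_on with
  | zero => simp
  | add x y hx hy => simp only [map_add, hx, hy]
  | tmul c h =>
    rw [Algebra.TensorProduct.map_tmul, twistComul_tmul,
      Algebra.TensorProduct.includeRight_apply, coactLeft_one_tmul]
    have e : (((1 : A) ⊗ₜ[k] c) ⊗ₜ[k] (1 : H)) ⊗ₜ[k] (1 : H) =
        comulRight k H _ (((1 : A) ⊗ₜ[k] c) ⊗ₜ[k] (1 : H)) := by
      rw [comulRight_tmul, Bialgebra.comul_one, Algebra.TensorProduct.one_def,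
        TensorProduct.assoc_symm_tmul]
    rw [e, ← map_mul, Algebra.TensorProduct.tmul_mul_tmul, mul_one, one_mul]

lemma evalCounit_galoisMap {E : Type*} [Ring E] [Algebra k E] (j : A →ₐ[k] E) (x : E) (a : A) :
    evalCounit k H E (galoisMap H j (x ⊗ₜ a)) = x * j a := by
  have key : ∀ t : A ⊗[k] H, evalCounit k H E
      ((x ⊗ₜ 1) * Algebra.TensorProduct.map j (AlgHom.id k H) t) =
      x * j (evalCounit k H A t) := by
    intro t
    induction t using TensorProduct.induction_on with
    | zero => simp
    | add x y hx hy => simp only [mul_add, map_add, hx, hy]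
    | tmul c h => simp
  rw [galoisMap_tmul, key, evalCounit, LinearMap.comp_apply,
    RightComoduleAlgebra.counit_coact]
  simp

end HopfCoactions

/-! ### Coinvariants of the cotensor product. -/

section Coinvariants

variable (k : Type*) (H : Type*) (A A' : Type*) [Field k] [Ring H] [Bialgebra k H]
  [Ring A] [Algebra k A] [RightComoduleAlgebra k H A]
  [Ring A'] [Algebra k A'] [RightComoduleAlgebra k H A']

/-- The inclusion `B ⊗ B' → A ⊗ A'`. -/
abbrev coinvIncl : coinvariants k H A ⊗[k] coinvariants k H A' →ₐ[k] A ⊗[k] A' :=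
  Algebra.TensorProduct.map (coinvariants k H A).val (coinvariants k H A').val

variable {k H A A'}

lemma coaction_coe (b : coinvariants k H A) : coaction k H A (b : A) = (b : A) ⊗ₜ 1 := b.2

lemma coactLeft_coinvIncl (z : coinvariants k H A ⊗[k] coinvariants k H A') :
    coactLeft k H A A' (coinvIncl k H A A' z) = coinvIncl k H A A' z ⊗ₜ 1 := by
  induction z using TensorProduct.induction_on with
  | zero => simp
  | add x y hx hy => simp only [map_add, TensorProduct.add_tmul, hx, hy]
  | tmul b b' =>
    rw [Algebra.TensorProduct.map_tmul, coactLeft_tmul]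
    simp [coaction_coe]

lemma coactRight_coinvIncl (z : coinvariants k H A ⊗[k] coinvariants k H A') :
    coactRight k H A A' (coinvIncl k H A A' z) = coinvIncl k H A A' z ⊗ₜ 1 := by
  induction z using TensorProduct.induction_on with
  | zero => simp
  | add x y hx hy => simp only [map_add, TensorProduct.add_tmul, hx, hy]
  | tmul b b' =>
    rw [Algebra.TensorProduct.map_tmul, coactRight_tmul]
    simp [coaction_coe]

variable (k H A) in
/-- The difference `ρ - (- ⊗ 1)`, whose kernel is the subalgebra of coinvariants. -/
def coactionSub : A →ₗ[k] A ⊗[k] H :=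
  (coaction k H A).toLinearMap -
    (Algebra.TensorProduct.includeLeft : A →ₐ[k] A ⊗[k] H).toLinearMap

lemma exact_coactionSub :
    Function.Exact (coinvariants k H A).val.toLinearMap (coactionSub k H A) := by
  intro y
  constructor
  · intro hy
    exact ⟨⟨y, sub_eq_zero.1 hy⟩, rfl⟩
  · rintro ⟨y, rfl⟩
    exact sub_eq_zero.2 y.2

/-- `A ⊗ -` and `- ⊗ B'` preserve the kernels defining `B'` and `B`: invariance on the right puts
`x` in `A ⊗ B'`, and invariance on the left then puts it in `B ⊗ B'`. -/
lemma exists_coinvIncl_eq {x : A ⊗[k] A'} (hl : coactLeft k H A A' x = x ⊗ₜ 1)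
    (hr : coactRight k H A A' x = x ⊗ₜ 1) : ∃ z, coinvIncl k H A A' z = x := by
  have h1 : (coactionSub k H A').lTensor A x = 0 := by
    apply (TensorProduct.assoc k A A' H).symm.injective
    have : ∀ y : A ⊗[k] A', (TensorProduct.assoc k A A' H).symm
        ((coactionSub k H A').lTensor A y) = coactRight k H A A' y - y ⊗ₜ 1 := by
      intro y
      induction y using TensorProduct.induction_on with
      | zero => simp
      | add x y hx hy => simp only [map_add, TensorProduct.add_tmul, hx, hy]; abel
      | tmul a a' =>
        rw [LinearMap.lTensor_tmul, coactRight_tmul]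
        simp [coactionSub, TensorProduct.tmul_sub]
    rw [this, hr, sub_self, map_zero]
  obtain ⟨y, rfl⟩ := (Module.Flat.lTensor_exact A exact_coactionSub x).1 h1
  have h2 : (coactionSub k H A).rTensor A'
      ((coinvariants k H A').val.toLinearMap.lTensor A y) = 0 := by
    apply (TensorProduct.rightComm k A H A').injective
    have : ∀ y : A ⊗[k] A', TensorProduct.rightComm k A H A'
        ((coactionSub k H A).rTensor A' y) = coactLeft k H A A' y - y ⊗ₜ 1 := by
      intro y
      induction y using TensorProduct.induction_on with
      | zero => simp
      | add x y hx hy => simp only [map_add, TensorProduct.add_tmul, hx, hy]; abel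
      | tmul a a' =>
        rw [LinearMap.rTensor_tmul, coactLeft_tmul]
        simp [coactionSub, TensorProduct.sub_tmul]
    rw [this, hl, sub_self, map_zero]
  -- The left invariance is known only in `(A ⊗ H) ⊗ A'`; it descends because `(A ⊗ H) ⊗ B'` embeds
  -- there.
  have h3 : (coactionSub k H A).rTensor (coinvariants k H A') y = 0 := by
    apply Module.Flat.lTensor_preserves_injective_linearMap (M := A ⊗[k] H)
      (coinvariants k H A').val.toLinearMap Subtype.val_injective
    rw [map_zero, ← h2, ← LinearMap.comp_apply, ← LinearMap.comp_apply,
      LinearMap.lTensor_comp_rTensor, LinearMap.rTensor_comp_lTensor]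
  obtain ⟨z, rfl⟩ := (Module.Flat.rTensor_exact _ exact_coactionSub y).1 h3
  refine ⟨z, ?_⟩
  rw [← LinearMap.comp_apply, LinearMap.lTensor_comp_rTensor]
  rfl

variable [Coalgebra.IsCocomm k H]

lemma cotensorIncl_coaction (x : cotensor k H A A') :
    cotensorIncl k H A A' (coaction k H (cotensor k H A A') x) = coactRight k H A A' x :=
  cotensorIncl_coact x

lemma mem_coinvariants_cotensor_iff (x : cotensor k H A A') :
    x ∈ coinvariants k H (cotensor k H A A') ↔
      coactRight k H A A' (x : A ⊗[k] A') = (x : A ⊗[k] A') ⊗ₜ 1 := by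
  rw [← cotensorIncl_coaction]
  exact (cotensorIncl_injective k H A A').eq_iff.symm

variable (k H A A') in
/-- The map `B ⊗ B' → (A □_H A')^{co H}`. -/
def toCoinvariantsCotensor : coinvariants k H A ⊗[k] coinvariants k H A' →ₐ[k]
    coinvariants k H (cotensor k H A A') :=
  ((coinvIncl k H A A').codRestrict (cotensor k H A A') fun z =>
      (coactLeft_coinvIncl z).trans (coactRight_coinvIncl z).symm).codRestrict _
    fun z => (mem_coinvariants_cotensor_iff _).2 (coactRight_coinvIncl z)

lemma coe_toCoinvariantsCotensor (z : coinvariants k H A ⊗[k] coinvariants k H A') :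
    ((toCoinvariantsCotensor k H A A' z : cotensor k H A A') : A ⊗[k] A') =
      coinvIncl k H A A' z := rfl

lemma toCoinvariantsCotensor_bijective :
    Function.Bijective (toCoinvariantsCotensor k H A A') := by
  constructor
  · have h : Function.Injective (coinvIncl k H A A') := by
      have h1 := Module.Flat.rTensor_preserves_injective_linearMap
        (M := coinvariants k H A') (coinvariants k H A).val.toLinearMap Subtype.val_injective
      have h2 := Module.Flat.lTensor_preserves_injective_linearMap (M := A)
        (coinvariants k H A').val.toLinearMap Subtype.val_injective
      have e : ⇑(coinvIncl k H A A') = (coinvariants k H A').val.toLinearMap.lTensor A ∘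
          (coinvariants k H A).val.toLinearMap.rTensor (coinvariants k H A') := by
        rw [← LinearMap.coe_comp, LinearMap.lTensor_comp_rTensor]
        rfl
      rw [e]
      exact h2.comp h1
    intro x y hxy
    apply h
    rw [← coe_toCoinvariantsCotensor, hxy, coe_toCoinvariantsCotensor]
  · intro d
    have hr := (mem_coinvariants_cotensor_iff _).1 d.2
    have hl : coactLeft k H A A' (d : cotensor k H A A') = _ := (d : cotensor k H A A').2
    obtain ⟨z, hz⟩ := exists_coinvIncl_eq (hl.trans hr) hr
    exact ⟨z, Subtype.ext (Subtype.ext hz)⟩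

end Coinvariants

/-! ### The isomorphism `(A □_H A') ⊗_{B'} A' ≅ A ⊗ A'`. -/

section KeyMap

variable {k : Type v} {H A A' : Type u} [Field k] [Ring H] [HopfAlgebra k H]
  [Ring A] [Algebra k A] [RightComoduleAlgebra k H A]
  [Ring A'] [Algebra k A'] [RightComoduleAlgebra k H A']

/-- The map `R ⊗ A' → A ⊗ A'`, `r ⊗ a' ↦ r (1 ⊗ a')`. -/
def mulRightFactor {R : Type*} [Ring R] [Algebra k R]
    (f : R →ₐ[k] A ⊗[k] A') : R ⊗[k] A' →ₗ[k] A ⊗[k] A' :=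
  LinearMap.mul' k (A ⊗[k] A') ∘ₗ TensorProduct.map f.toLinearMap
    (Algebra.TensorProduct.includeRight : A' →ₐ[k] A ⊗[k] A').toLinearMap

@[simp]
lemma mulRightFactor_tmul {R : Type*} [Ring R] [Algebra k R]
    (f : R →ₐ[k] A ⊗[k] A') (r : R) (a' : A') :
    mulRightFactor f (r ⊗ₜ a') = f r * (1 ⊗ₜ a') := rfl

variable (k H A A') in
/-- The difference of the two coactions, whose kernel is the cotensor product. -/
def coactSub : A ⊗[k] A' →ₗ[k] (A ⊗[k] A') ⊗[k] H :=
  (coactLeft k H A A').toLinearMap - (coactRight k H A A').toLinearMap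

lemma coactSub_apply (x : A ⊗[k] A') :
    coactSub k H A A' x = coactLeft k H A A' x - coactRight k H A A' x := rfl

lemma exact_coactSub :
    Function.Exact (cotensor k H A A').val.toLinearMap (coactSub k H A A') := by
  intro y
  constructor
  · intro hy
    exact ⟨⟨y, sub_eq_zero.1 hy⟩, rfl⟩
  · rintro ⟨y, rfl⟩
    exact sub_eq_zero.2 y.2

variable (k H A A') in
/-- The map corresponding to the difference of the two coactions on `A ⊗ A'`
under `(A ⊗ A') ⊗_{B'} A' ≅ (A ⊗ A') ⊗ H`. -/
def galoisSub : (A ⊗[k] A') ⊗[k] H →ₗ[k] ((A ⊗[k] A') ⊗[k] H) ⊗[k] H :=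
  twistComul (coactLeft k H A A') - (coactH (coactRight k H A A')).toLinearMap

/-- Sending `A'` into `(A ⊗ A') ⊗ H` by its own coaction turns the `coactRight` part into an algebra
map applied to `galoisMap`. The `coactLeft` part matches by coassociativity of `δ'` and because `δ`
fixes `1 ⊗ A'`. -/
lemma galoisSub_comp_galoisMap :
    galoisSub k H A A' ∘ₗ
        galoisMap H (Algebra.TensorProduct.includeRight : A' →ₐ[k] A ⊗[k] A') =
      galoisMap H ((coactRight k H A A').comp Algebra.TensorProduct.includeRight) ∘ₗ
        (coactSub k H A A').rTensor A' := by
  apply TensorProduct.ext'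
  intro c a'
  have e : Algebra.TensorProduct.map ((coactRight k H A A').comp
      Algebra.TensorProduct.includeRight) (AlgHom.id k H) (coaction k H A' a') =
      coactH (coactRight k H A A') (coactRight k H A A' (1 ⊗ₜ a')) := by
    rw [coactRight_one_tmul]
    induction coaction k H A' a' using TensorProduct.induction_on with
    | zero => simp
    | add x y hx hy => simp only [map_add, hx, hy]
    | tmul x h => simp
  simp only [LinearMap.comp_apply, LinearMap.rTensor_tmul, galoisMap_tmul, e, galoisSub,
    LinearMap.sub_apply, map_sub, AlgHom.toLinearMap_apply, map_mul, coactSub_apply,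
    TensorProduct.sub_tmul, coactH_tmul]
  rw [← coactRight_one_tmul, twistComul_mul, twistComul_coactLeft_one_tmul, coactH_coactRight]

variable [Coalgebra.IsCocomm k H]

variable (k H A A') in
/-- The map `B' → (A □_H A')^{co H}`, `b' ↦ 1 ⊗ b'`. -/
def coinvRight : coinvariants k H A' →ₐ[k] coinvariants k H (cotensor k H A A') :=
  (toCoinvariantsCotensor k H A A').comp Algebra.TensorProduct.includeRight

lemma Presents.mulRightFactor_cotensor (hA' : IsFaithfullyFlatGalois k H A') {Q : Type*} [AddCommGroup Q]
    [Module k Q] {Φ : cotensor k H A A' ⊗[k] A' →ₗ[k] Q}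
    (p₁ : Presents (balRel (rightAct ((coinvariants k H (cotensor k H A A')).val.comp
        (coinvRight k H A A'))) (leftAct (coinvariants k H A').val)) Φ) :
    Presents (balRel (rightAct ((coinvariants k H (cotensor k H A A')).val.comp
        (coinvRight k H A A'))) (leftAct (coinvariants k H A').val))
      (mulRightFactor (cotensor k H A A').val) := by
  obtain ⟨hcan, hflat⟩ := hA'
  have p₂ := presents_galoisMap hcan
    (Algebra.TensorProduct.includeRight : A' →ₐ[k] A ⊗[k] A')
  have p₃ := presents_galoisMap hcan ((coactRight k H A A').comp
    (Algebra.TensorProduct.includeRight : A' →ₐ[k] A ⊗[k] A'))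
  have hf : ∀ b r, (cotensor k H A A').val.toLinearMap
      (rightAct ((coinvariants k H (cotensor k H A A')).val.comp (coinvRight k H A A')) b r) =
      rightAct ((Algebra.TensorProduct.includeRight : A' →ₐ[k] A ⊗[k] A').comp
        (coinvariants k H A').val) b ((cotensor k H A A').val.toLinearMap r) :=
    fun b r => rfl
  have hg : ∀ b c, coactSub k H A A'
      (rightAct ((Algebra.TensorProduct.includeRight : A' →ₐ[k] A ⊗[k] A').comp
        (coinvariants k H A').val) b c) =
      rightAct (((coactRight k H A A').comp
        (Algebra.TensorProduct.includeRight : A' →ₐ[k] A ⊗[k] A')).comp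
        (coinvariants k H A').val) b (coactSub k H A A' c) := by
    intro b c
    obtain ⟨b, rfl⟩ := MulOpposite.op_surjective b
    -- The two coactions agree on `1 ⊗ b'`, which lies in the cotensor product; this makes their
    -- difference `B'`-linear.
    have hb : coactLeft k H A A' (1 ⊗ₜ (b : A')) = coactRight k H A A' (1 ⊗ₜ (b : A')) :=
      (coinvRight k H A A' b : cotensor k H A A').2
    simp only [rightAct_apply, AlgHom.comp_apply, Subalgebra.coe_val, coactSub_apply, map_mul,
      Algebra.TensorProduct.includeRight_apply, hb, sub_mul]
  obtain ⟨F, hF⟩ := p₁.exists_lift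
    (galoisMap H Algebra.TensorProduct.includeRight ∘ₗ
      (cotensor k H A A').val.toLinearMap.rTensor A') (fun b => by
    rw [LinearMap.comp_assoc, rTensor_comp_balRel _ hf, ← LinearMap.comp_assoc,
      p₂.comp_rel, LinearMap.zero_comp])
  have ht : ∀ (b : coinvariants k H A') (n : A'),
      leftAct (coinvariants k H A').val b n = b • n := fun _ _ => rfl
  -- With `inj` below, flatness identifies `Q` with the kernel of `galoisSub`, the solution set of
  -- the twisted equation.
  have ex : Function.Exact F (galoisSub k H A A') :=
    (hflat.exact_iff ht hf hg p₁ p₂ p₃ hF galoisSub_comp_galoisMap).1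
      exact_coactSub
  have inj : Function.Injective F :=
    hflat.injective ht hf p₁ p₂ hF Subtype.val_injective
  -- Evaluating the Galois map at the counit recovers multiplication, so the bijection given by the
  -- twist argument is the multiplication map itself.
  have hmul : (evalCounit k H _ ∘ₗ F) ∘ₗ Φ = mulRightFactor (cotensor k H A A').val := by
    rw [LinearMap.comp_assoc, hF]
    apply TensorProduct.ext'
    intro r a'
    exact evalCounit_galoisMap _ (r : A ⊗[k] A') a'
  have hbij : Function.Bijective (evalCounit k H _ ∘ₗ F) := by
    constructor
    · rw [injective_iff_map_eq_zero]
      intro q hq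
      apply inj
      rw [map_zero]
      exact eq_zero_of_evalCounit_eq_zero coactH_coactLeft coactLeft_counit
        (sub_eq_zero.1 ((ex _).2 ⟨q, rfl⟩)) hq
    · intro x
      obtain ⟨z, hz, rfl⟩ := exists_evalCounit_eq (δ := coactLeft k H A A')
        (δ' := coactRight k H A A') coactH_coactLeft coactLeft_counit coactH_coactRight
        coactRight_counit coactH_coactLeft_coactRight x
      obtain ⟨q, rfl⟩ := (ex z).1 (sub_eq_zero.2 hz)
      exact ⟨q, rfl⟩
  rw [← hmul]
  exact p₁.equiv_comp (LinearEquiv.ofBijective _ hbij)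

/-- The map `(A □_H A') ⊗ A' → A ⊗ A'` identifies `(A □_H A') ⊗_{B'} A'` with `A ⊗ A'`. -/
lemma presents_mulRightFactor_cotensor (hA' : IsFaithfullyFlatGalois k H A') :
    Presents (balRel (rightAct ((coinvariants k H (cotensor k H A A')).val.comp
        (coinvRight k H A A'))) (leftAct (coinvariants k H A').val))
      (mulRightFactor (cotensor k H A A').val) :=
  (Presents.mkQ _).mulRightFactor_cotensor hA'

end KeyMap

/-! ### Iterated balanced tensor products. -/

section Iterate

variable {k : Type*} [CommRing k] {B : Type*} [Ring B] [Algebra k B]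
  {X F N P : Type*} [AddCommGroup X] [Module k X] [AddCommGroup F] [Module k F]
  [AddCommGroup N] [Module k N] [AddCommGroup P] [Module k P] {ι : Type*}

/-- A presentation of an iterated balanced tensor product restricts to a presentation of the
outer one. -/
lemma Presents.exists_outer {d : ι → Module.End k X} {q : X →ₗ[k] F} (hq : Presents d q)
    {s : Bᵐᵒᵖ →ₐ[k] Module.End k X} {τ : Bᵐᵒᵖ →ₐ[k] Module.End k F}
    (hτ : ∀ b x, τ b (q x) = q (s b x)) {t : B →ₐ[k] Module.End k N} {p : X ⊗[k] N →ₗ[k] P}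
    (hp : Presents (Sum.elim (fun i => (d i).rTensor N) (balRel s t)) p) :
    ∃ w : F ⊗[k] N →ₗ[k] P, w ∘ₗ q.rTensor N = p ∧ Presents (balRel τ t) w := by
  obtain ⟨w, rfl⟩ := (hq.rTensor N).exists_lift p fun i => hp.comp_rel (Sum.inl i)
  refine ⟨w, rfl, hp.of_comp (hq.rTensor N).surjective (fun i => ?_) fun b => ?_⟩
  · exact (hq.rTensor N).comp_rel i
  · exact rTensor_comp_balRel t (fun b x => (hτ b x).symm) b

lemma Presents.iterate {d : ι → Module.End k X} {q : X →ₗ[k] F} (hq : Presents d q)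
    {s : Bᵐᵒᵖ →ₐ[k] Module.End k X} {τ : Bᵐᵒᵖ →ₐ[k] Module.End k F}
    (hτ : ∀ b x, τ b (q x) = q (s b x)) {t : B →ₐ[k] Module.End k N} {w : F ⊗[k] N →ₗ[k] P}
    (hw : Presents (balRel τ t) w) :
    Presents (Sum.elim (fun i => (d i).rTensor N) (balRel s t)) (w ∘ₗ q.rTensor N) :=
  (hq.rTensor N).comp hw _ fun b => rTensor_comp_balRel t (fun b x => (hτ b x).symm) b

lemma Presents.swap {κ : Type*} {d : ι → Module.End k X} {e : κ → Module.End k X}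
    {q : X →ₗ[k] F} (hq : Presents (Sum.elim d e) q) : Presents (Sum.elim e d) q :=
  hq.congr_rel (by simp only [iSup_sum, Sum.elim_inl, Sum.elim_inr]; exact sup_comm _ _)

end Iterate

/-! ### Balancing over an algebra generated by two subalgebras, and reassociation. -/

section Generators

variable {k : Type*} [CommRing k] {B B' D : Type*} [Ring B] [Algebra k B] [Ring B'] [Algebra k B']
  [Ring D] [Algebra k D] {M N : Type*} [AddCommGroup M] [Module k M] [AddCommGroup N] [Module k N]

/-- Balancing over `D` is the same as balancing over `B` and `B'` if `D` is spanned by products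
of elements of `B` and `B'`. -/
lemma iSup_range_balRel_of_span {φ : B ⊗[k] B' →ₐ[k] D}
    (hφ : Function.Surjective φ) {i : B →ₐ[k] D} {j : B' →ₐ[k] D}
    (hi : φ.comp Algebra.TensorProduct.includeLeft = i)
    (hj : φ.comp Algebra.TensorProduct.includeRight = j)
    (σ : Dᵐᵒᵖ →ₐ[k] Module.End k M) (t : D →ₐ[k] Module.End k N) :
    (⨆ d, LinearMap.range (balRel σ t d)) =
      ⨆ x, LinearMap.range (Sum.elim (balRel (σ.comp (AlgHom.op i)) (t.comp i))
        (balRel (σ.comp (AlgHom.op j)) (t.comp j)) x) := by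
  rw [iSup_sum]
  simp only [Sum.elim_inl, Sum.elim_inr]
  apply le_antisymm
  · refine iSup_le fun d => ?_
    obtain ⟨z, rfl⟩ := hφ d
    rintro _ ⟨y, rfl⟩
    induction z using TensorProduct.induction_on with
    | zero =>
      have : balRel σ t 0 = 0 := by
        apply TensorProduct.ext'
        intro m n
        simp
      simp [this]
    | add x y hx hy =>
      rw [map_add, balRel_add]
      exact add_mem hx hy
    | tmul b b' =>
      have e : φ (b ⊗ₜ b') = i b * j b' := by simp [← hi, ← hj, ← map_mul]
      rw [e, balRel_mul]
      exact add_mem (Submodule.mem_sup_right (Submodule.mem_iSup_of_mem b' ⟨_, rfl⟩))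
        (Submodule.mem_sup_left (Submodule.mem_iSup_of_mem b ⟨_, rfl⟩))
  · refine sup_le (iSup_le fun b => ?_) (iSup_le fun b' => ?_)
    · exact le_iSup (fun d => LinearMap.range (balRel σ t d)) (i b)
    · exact le_iSup (fun d => LinearMap.range (balRel σ t d)) (j b')

/-- If `N ⊗_{B'} W ≅ Z` as modules over `B` and `B'`, then `(M ⊗_D N) ⊗_{B'} W` is the quotient of
`M ⊗ Z` by the relations over `B` and `B'`. -/
lemma Presents.comp_lTensor_assoc {φ : B ⊗[k] B' →ₐ[k] D}
    (hφ : Function.Surjective φ) {i : B →ₐ[k] D} {j : B' →ₐ[k] D}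
    (hi : φ.comp Algebra.TensorProduct.includeLeft = i)
    (hj : φ.comp Algebra.TensorProduct.includeRight = j)
    {W Z P : Type*} [AddCommGroup W] [Module k W] [AddCommGroup Z] [Module k Z]
    [AddCommGroup P] [Module k P]
    {s : B'ᵐᵒᵖ →ₐ[k] Module.End k N} {t : B' →ₐ[k] Module.End k W} {κ : N ⊗[k] W →ₗ[k] Z}
    (hκ : Presents (balRel s t) κ) {l : D →ₐ[k] Module.End k N}
    {u : B →ₐ[k] Module.End k Z} {u' : B' →ₐ[k] Module.End k Z}
    (hu : ∀ b n w, κ (l (i b) n ⊗ₜ w) = u b (κ (n ⊗ₜ w)))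
    (hu' : ∀ b n w, κ (l (j b) n ⊗ₜ w) = u' b (κ (n ⊗ₜ w)))
    {σ : Dᵐᵒᵖ →ₐ[k] Module.End k M} {p : M ⊗[k] Z →ₗ[k] P}
    (hp : Presents (Sum.elim (balRel (σ.comp (AlgHom.op i)) u)
      (balRel (σ.comp (AlgHom.op j)) u')) p) :
    Presents (Sum.elim (fun d => (balRel σ l d).rTensor W)
      (balRel ((Module.End.lTensorAlgHom k N M).comp s) t))
      (p ∘ₗ κ.lTensor M ∘ₗ (TensorProduct.assoc k M N W).toLinearMap) := by
  let l' : D →ₐ[k] Module.End k (N ⊗[k] W) := (Module.End.rTensorAlgHom k N W).comp l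
  have hl : ∀ b z, κ (l' (i b) z) = u b (κ z) := fun b z =>
    LinearMap.congr_fun (f := κ ∘ₗ l' (i b)) (g := u b ∘ₗ κ) (TensorProduct.ext' (hu b)) z
  have hl' : ∀ b z, κ (l' (j b) z) = u' b (κ z) := fun b z =>
    LinearMap.congr_fun (f := κ ∘ₗ l' (j b)) (g := u' b ∘ₗ κ) (TensorProduct.ext' (hu' b)) z
  have h1 := (hκ.lTensor M).comp hp
    (Sum.elim (balRel (σ.comp (AlgHom.op i)) (l'.comp i))
      (balRel (σ.comp (AlgHom.op j)) (l'.comp j)))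
    (by
      rintro (b | b)
      · exact lTensor_comp_balRel _ (hl b)
      · exact lTensor_comp_balRel _ (hl' b))
  -- The relations over `B` and `B'`, lifted to `M ⊗ (N ⊗ W)`, together generate those over `D`.
  have h2 := h1.congr_rel (e := Sum.elim (fun b => (balRel s t b).lTensor M) (balRel σ l')) (by
    have hspan := iSup_range_balRel_of_span hφ hi hj σ l'
    rw [iSup_sum]
    conv_rhs => rw [iSup_sum]
    simp only [Sum.elim_inl, Sum.elim_inr]
    rw [hspan])
  refine h2.swap.conj (TensorProduct.assoc k M N W) _ ?_
  rintro (d | b)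
  · ext m n w
    simp [l', TensorProduct.sub_tmul]
    rfl
  · ext m n w
    simp [TensorProduct.tmul_sub]
    rfl

end Generators

/-! ### Base change of `M ⊗_D R` along `B' → A'`. -/

section Extension

variable {k : Type v} {H A A' : Type u} [Field k] [Ring H] [HopfAlgebra k H]
  [Ring A] [Algebra k A] [RightComoduleAlgebra k H A]
  [Ring A'] [Algebra k A'] [RightComoduleAlgebra k H A']
  {R D : Type u} [Ring R] [Algebra k R] [Ring D] [Algebra k D]

variable (k H A A' R D) in
/-- An algebra `R` over `A ⊗ A'` with `R ⊗_{B'} A' ≅ A ⊗ A'`, equalizing the two coactions of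
`A ⊗ A'` compatibly with a coaction of its own, and an algebra `D` generated by `B` and `B'`
which maps to the coinvariants of `R`. -/
structure CotensorExtension where
  /-- The map `R → A ⊗ A'`. -/
  incl : R →ₐ[k] A ⊗[k] A'
  /-- The coaction of `R`. -/
  coact : R →ₐ[k] R ⊗[k] H
  /-- The map `D → R`. -/
  base : D →ₐ[k] R
  /-- The map `B ⊗ B' → D`. -/
  coinv : coinvariants k H A ⊗[k] coinvariants k H A' →ₐ[k] D
  coinv_surjective : Function.Surjective coinv
  incl_base_coinv : ∀ z, incl (base (coinv z)) = coinvIncl k H A A' z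
  coact_base : ∀ d, coact (base d) = base d ⊗ₜ 1
  map_coact : ∀ r, Algebra.TensorProduct.map incl (AlgHom.id k H) (coact r) =
    coactLeft k H A A' (incl r)
  presents : Presents (balRel (rightAct (base.comp (coinv.comp
    (Algebra.TensorProduct.includeRight : coinvariants k H A' →ₐ[k] _))))
    (leftAct (coinvariants k H A').val)) (mulRightFactor incl)

namespace CotensorExtension

variable (T : CotensorExtension k H A A' R D)

/-- The map `B → D`. -/
def left : coinvariants k H A →ₐ[k] D := T.coinv.comp Algebra.TensorProduct.includeLeft

/-- The map `B' → D`. -/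
def right : coinvariants k H A' →ₐ[k] D := T.coinv.comp Algebra.TensorProduct.includeRight

@[simp]
lemma incl_base_left (b : coinvariants k H A) : T.incl (T.base (T.left b)) = (b : A) ⊗ₜ 1 :=
  T.incl_base_coinv _

@[simp]
lemma incl_base_right (b : coinvariants k H A') :
    T.incl (T.base (T.right b)) = 1 ⊗ₜ (b : A') :=
  T.incl_base_coinv _

lemma left_mul_right (b : coinvariants k H A) (b' : coinvariants k H A') :
    T.left b * T.right b' = T.right b' * T.left b := by
  simp [left, right, ← map_mul]

variable {M : Type u} [AddCommGroup M] [Module k M]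

variable (M) in
/-- The map `(M ⊗ R) ⊗ A' → M ⊗ (A ⊗ A')`, `m ⊗ r ⊗ a' ↦ m ⊗ r (1 ⊗ a')`. -/
def lTensorMul : (M ⊗[k] R) ⊗[k] A' →ₗ[k] M ⊗[k] (A ⊗[k] A') :=
  (mulRightFactor T.incl).lTensor M ∘ₗ (TensorProduct.assoc k M R A').toLinearMap

@[simp]
lemma lTensorMul_tmul (m : M) (r : R) (a' : A') :
    T.lTensorMul M ((m ⊗ₜ r) ⊗ₜ a') = m ⊗ₜ (T.incl r * (1 ⊗ₜ a')) := rfl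

/-- The right action of `B'` on `M ⊗ R`. -/
def tensorAct (M : Type u) [AddCommGroup M] [Module k M] :
    (coinvariants k H A')ᵐᵒᵖ →ₐ[k] Module.End k (M ⊗[k] R) :=
  (Module.End.lTensorAlgHom k R M).comp (rightAct (T.base.comp T.right))

@[simp]
lemma tensorAct_tmul (b : coinvariants k H A') (m : M) (r : R) :
    T.tensorAct M (MulOpposite.op b) (m ⊗ₜ r) = m ⊗ₜ (r * T.base (T.right b)) := rfl

/-- The relations defining `M ⊗_{B ⊗ B'} (A ⊗ A')`. -/
def biRel (σ : Dᵐᵒᵖ →ₐ[k] Module.End k M) :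
    coinvariants k H A ⊕ coinvariants k H A' → Module.End k (M ⊗[k] (A ⊗[k] A')) :=
  Sum.elim
    (balRel (σ.comp (AlgHom.op T.left))
      (leftAct ((Algebra.TensorProduct.includeLeft : A →ₐ[k] A ⊗[k] A').comp
        (coinvariants k H A).val)))
    (balRel (σ.comp (AlgHom.op T.right))
      (leftAct ((Algebra.TensorProduct.includeRight : A' →ₐ[k] A ⊗[k] A').comp
        (coinvariants k H A').val)))

/-- `(M ⊗_D R) ⊗_{B'} A' ≅ M ⊗_{B ⊗ B'} (A ⊗ A')`. -/
lemma presents_comp_lTensorMul {P : Type*} [AddCommGroup P] [Module k P]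
    {σ : Dᵐᵒᵖ →ₐ[k] Module.End k M} {p : M ⊗[k] (A ⊗[k] A') →ₗ[k] P}
    (hp : Presents (T.biRel σ) p) :
    Presents (Sum.elim (fun d => (balRel σ (leftAct T.base) d).rTensor A')
      (balRel (T.tensorAct M) (leftAct (coinvariants k H A').val)))
      (p ∘ₗ T.lTensorMul M) := by
  refine Presents.comp_lTensor_assoc T.coinv_surjective rfl rfl T.presents
    (i := T.left) (j := T.right) (l := leftAct T.base) ?_ ?_ hp
  · intro b r a'
    simp [mul_assoc]
  · intro b r a'
    simp [mul_assoc]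

/-- `(M ⊗_D R) ⊗_{B'} A' ≅ M ⊗_{B ⊗ B'} (A ⊗ A')`, for an arbitrary model `F` of `M ⊗_D R`. -/
lemma exists_presents {F P : Type*} [AddCommGroup F] [Module k F] [AddCommGroup P] [Module k P]
    {σ : Dᵐᵒᵖ →ₐ[k] Module.End k M} {q : M ⊗[k] R →ₗ[k] F}
    (hq : Presents (balRel σ (leftAct T.base)) q) {p : M ⊗[k] (A ⊗[k] A') →ₗ[k] P}
    (hp : Presents (T.biRel σ) p) :
    ∃ (τ : (coinvariants k H A')ᵐᵒᵖ →ₐ[k] Module.End k F) (w : F ⊗[k] A' →ₗ[k] P),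
      (∀ b x, τ b (q x) = q (T.tensorAct M b x)) ∧
      w ∘ₗ q.rTensor A' = p ∘ₗ T.lTensorMul M ∧
      Presents (balRel τ (leftAct (coinvariants k H A').val)) w := by
  obtain ⟨τ, hτ⟩ := exists_descended_action hq (T.tensorAct M) (fun b d => by
    obtain ⟨b, rfl⟩ := MulOpposite.op_surjective b
    have e : T.tensorAct M (MulOpposite.op b) ∘ₗ balRel σ (leftAct T.base) d =
        balRel σ (leftAct T.base) d ∘ₗ T.tensorAct M (MulOpposite.op b) := by
      apply TensorProduct.ext'
      intro m r
      simp [mul_assoc]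
    rw [e, ← LinearMap.comp_assoc, hq.comp_rel, LinearMap.zero_comp])
  obtain ⟨w, hw, hw'⟩ := hq.exists_outer hτ (T.presents_comp_lTensorMul hp)
  exact ⟨τ, w, hτ, hw, hw'⟩

/-- A presentation of `(M ⊗_B A) ⊗_{B'} A'`. -/
lemma presents_iterated {V P : Type*} [AddCommGroup V] [Module k V] [AddCommGroup P] [Module k P]
    {σ : Dᵐᵒᵖ →ₐ[k] Module.End k M} {v : M ⊗[k] A →ₗ[k] V}
    (hv : Presents (balRel (σ.comp (AlgHom.op T.left)) (leftAct (coinvariants k H A).val)) v)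
    {τ : (coinvariants k H A')ᵐᵒᵖ →ₐ[k] Module.End k V}
    (hτ : ∀ b x, τ b (v x) = v ((σ (MulOpposite.op (T.right b.unop))).rTensor A x))
    {w : V ⊗[k] A' →ₗ[k] P}
    (hw : Presents (balRel τ (leftAct (coinvariants k H A').val)) w) :
    Presents (T.biRel σ) (w ∘ₗ v.rTensor A' ∘ₗ (TensorProduct.assoc k M A A').symm.toLinearMap) := by
  refine (hv.iterate (s := (Module.End.rTensorAlgHom k M A).comp
    (σ.comp (AlgHom.op T.right))) hτ hw).conj (TensorProduct.assoc k M A A').symm _ ?_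
  rintro (b | b)
  · ext m a a'
    simp [biRel, TensorProduct.sub_tmul]
  · ext m a a'
    simp [biRel]
    rfl

/-- The action of `B'` on `M` descends to `M ⊗_B A` because the images of `B` and `B'` in `D`
commute. -/
lemma exists_action {V : Type*} [AddCommGroup V] [Module k V]
    {σ : Dᵐᵒᵖ →ₐ[k] Module.End k M} {v : M ⊗[k] A →ₗ[k] V}
    (hv : Presents (balRel (σ.comp (AlgHom.op T.left)) (leftAct (coinvariants k H A).val)) v) :
    ∃ τ : (coinvariants k H A')ᵐᵒᵖ →ₐ[k] Module.End k V,
      ∀ b x, τ b (v x) = v ((σ (MulOpposite.op (T.right b.unop))).rTensor A x) := by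
  refine exists_descended_action hv ((Module.End.rTensorAlgHom k M A).comp
    (σ.comp (AlgHom.op T.right))) (fun b b' => ?_)
  obtain ⟨b, rfl⟩ := MulOpposite.op_surjective b
  have e : (σ (MulOpposite.op (T.right b))).rTensor A ∘ₗ
      balRel (σ.comp (AlgHom.op T.left)) (leftAct (coinvariants k H A).val) b' =
      balRel (σ.comp (AlgHom.op T.left)) (leftAct (coinvariants k H A).val) b' ∘ₗ
        (σ (MulOpposite.op (T.right b))).rTensor A := by
    refine rTensor_comp_balRel _ (fun c m => ?_) b'
    obtain ⟨c, rfl⟩ := MulOpposite.op_surjective c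
    have := congrArg (fun x => σ (MulOpposite.op x) m) (T.left_mul_right c b)
    simpa using this
  refine Eq.trans (congrArg (v ∘ₗ ·) e) ?_
  change v ∘ₗ (_ ∘ₗ _) = 0
  rw [← LinearMap.comp_assoc, hv.comp_rel, LinearMap.zero_comp]

end CotensorExtension

end Extension

namespace CotensorExtension

variable {k : Type v} {H A A' : Type u} [Field k] [Ring H] [HopfAlgebra k H]
  [Ring A] [Algebra k A] [RightComoduleAlgebra k H A]
  [Ring A'] [Algebra k A'] [RightComoduleAlgebra k H A']
  {R D : Type u} [Ring R] [Algebra k R] [Ring D] [Algebra k D]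
  (T : CotensorExtension k H A A' R D)

/-! ### Faithful flatness of `R` over `D`. -/

section FaithfullyFlat

variable {M M₁ M₂ M₃ F F₁ F₂ F₃ V V₁ V₂ V₃ P P₁ P₂ P₃ : Type u}
  [AddCommGroup M] [Module k M] [AddCommGroup F] [Module k F]
  [AddCommGroup V] [Module k V] [AddCommGroup P] [Module k P]
  [AddCommGroup M₁] [Module k M₁] [AddCommGroup F₁] [Module k F₁]
  [AddCommGroup V₁] [Module k V₁] [AddCommGroup P₁] [Module k P₁]
  [AddCommGroup M₂] [Module k M₂] [AddCommGroup F₂] [Module k F₂]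
  [AddCommGroup V₂] [Module k V₂] [AddCommGroup P₂] [Module k P₂]
  [AddCommGroup M₃] [Module k M₃] [AddCommGroup F₃] [Module k F₃]

/-- Models `V` of `M ⊗_B A` and `P` of `(M ⊗_B A) ⊗_{B'} A' ≅ F ⊗_{B'} A'`, where `F` is a model
of `M ⊗_D R`. -/
structure Tower (σ : Dᵐᵒᵖ →ₐ[k] Module.End k M) (q : M ⊗[k] R →ₗ[k] F)
    (V P : Type u) [AddCommGroup V] [Module k V] [AddCommGroup P] [Module k P] where
  /-- The quotient map `M ⊗ A → M ⊗_B A`. -/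
  toV : M ⊗[k] A →ₗ[k] V
  /-- The action of `B'` on `M ⊗_B A`. -/
  actV : (coinvariants k H A')ᵐᵒᵖ →ₐ[k] Module.End k V
  /-- The quotient map `(M ⊗_B A) ⊗ A' → (M ⊗_B A) ⊗_{B'} A'`. -/
  toP : V ⊗[k] A' →ₗ[k] P
  /-- The action of `B'` on `M ⊗_D R`. -/
  actF : (coinvariants k H A')ᵐᵒᵖ →ₐ[k] Module.End k F
  /-- The quotient map `(M ⊗_D R) ⊗ A' → (M ⊗_D R) ⊗_{B'} A'`. -/
  ofF : F ⊗[k] A' →ₗ[k] P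
  presents_toV :
    Presents (balRel (σ.comp (AlgHom.op T.left)) (leftAct (coinvariants k H A).val)) toV
  actV_toV : ∀ b x, actV b (toV x) = toV ((σ (MulOpposite.op (T.right b.unop))).rTensor A x)
  presents_toP : Presents (balRel actV (leftAct (coinvariants k H A').val)) toP
  actF_apply : ∀ b x, actF b (q x) = q (T.tensorAct M b x)
  presents_ofF : Presents (balRel actF (leftAct (coinvariants k H A').val)) ofF
  ofF_comp : ofF ∘ₗ q.rTensor A' =
    (toP ∘ₗ toV.rTensor A' ∘ₗ (TensorProduct.assoc k M A A').symm.toLinearMap) ∘ₗ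
      T.lTensorMul M

/-- The same `P` is a quotient of `V ⊗ A'` and of `F ⊗ A'`. Since `V` is later a test module for
flatness of `A'`, it has to live in the universe `u`. -/
lemma exists_tower {σ : Dᵐᵒᵖ →ₐ[k] Module.End k M} {q : M ⊗[k] R →ₗ[k] F}
    (hq : Presents (balRel σ (leftAct T.base)) q) :
    ∃ (V P : Type u) (_ : AddCommGroup V) (_ : Module k V) (_ : AddCommGroup P)
      (_ : Module k P), Nonempty (T.Tower σ q V P) := by
  have hv := Presents.mkQ
    (balRel (σ.comp (AlgHom.op T.left)) (leftAct (coinvariants k H A).val))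
  obtain ⟨τ, hτ⟩ := T.exists_action hv
  have hw := Presents.mkQ (balRel τ (leftAct (coinvariants k H A').val))
  obtain ⟨ν, ω, hν, hω, hω'⟩ := T.exists_presents hq (T.presents_iterated hv hτ hw)
  exact ⟨_, _, _, _, _, _, ⟨⟨_, τ, _, ν, ω, hv, hτ, hw, hν, hω', hω⟩⟩⟩

/-- Naturality of `(M ⊗_D R) ⊗_{B'} A' ≅ (M ⊗_B A) ⊗_{B'} A'` in `M`: one map `fP` is induced both
by `fV` and by `fF`. -/
lemma Tower.exists_map {T : CotensorExtension k H A A' R D}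
    {σ₁ : Dᵐᵒᵖ →ₐ[k] Module.End k M₁} {q₁ : M₁ ⊗[k] R →ₗ[k] F₁}
    {σ₂ : Dᵐᵒᵖ →ₐ[k] Module.End k M₂} {q₂ : M₂ ⊗[k] R →ₗ[k] F₂}
    (S₁ : T.Tower σ₁ q₁ V₁ P₁) (S₂ : T.Tower σ₂ q₂ V₂ P₂)
    (hq₁ : Function.Surjective q₁)
    {f : M₁ →ₗ[k] M₂} (hf : ∀ d m, f (σ₁ d m) = σ₂ d (f m))
    {fF : F₁ →ₗ[k] F₂} (hfF : fF ∘ₗ q₁ = q₂ ∘ₗ f.rTensor R) :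
    ∃ (fV : V₁ →ₗ[k] V₂) (fP : P₁ →ₗ[k] P₂),
      fV ∘ₗ S₁.toV = S₂.toV ∘ₗ f.rTensor A ∧ (∀ b x, fV (S₁.actV b x) = S₂.actV b (fV x)) ∧
      fP ∘ₗ S₁.toP = S₂.toP ∘ₗ fV.rTensor A' ∧ (∀ b x, fF (S₁.actF b x) = S₂.actF b (fF x)) ∧
      fP ∘ₗ S₁.ofF = S₂.ofF ∘ₗ fF.rTensor A' := by
  obtain ⟨fV, hfV⟩ := S₁.presents_toV.exists_lift (S₂.toV ∘ₗ f.rTensor A) (fun b => by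
    rw [LinearMap.comp_assoc, rTensor_comp_balRel (s' := σ₂.comp (AlgHom.op T.left)) _
      (fun b m => hf _ m), ← LinearMap.comp_assoc, S₂.presents_toV.comp_rel,
      LinearMap.zero_comp])
  have hfV' : ∀ x, fV (S₁.toV x) = S₂.toV (f.rTensor A x) := LinearMap.congr_fun hfV
  have hact : ∀ b x, fV (S₁.actV b x) = S₂.actV b (fV x) := by
    intro b x
    obtain ⟨x, rfl⟩ := S₁.presents_toV.surjective x
    rw [S₁.actV_toV, hfV', hfV', S₂.actV_toV, ← LinearMap.rTensor_comp_apply,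
      ← LinearMap.rTensor_comp_apply]
    congr 3
    exact LinearMap.ext (hf _)
  obtain ⟨fP, hfP⟩ := S₁.presents_toP.exists_lift (S₂.toP ∘ₗ fV.rTensor A') (fun b => by
    rw [LinearMap.comp_assoc, rTensor_comp_balRel _ hact, ← LinearMap.comp_assoc,
      S₂.presents_toP.comp_rel, LinearMap.zero_comp])
  have hfP' : ∀ x, fP (S₁.toP x) = S₂.toP (fV.rTensor A' x) := LinearMap.congr_fun hfP
  have hfF' : ∀ x, fF (q₁ x) = q₂ (f.rTensor R x) := LinearMap.congr_fun hfF
  refine ⟨fV, fP, hfV, hact, hfP, ?_, ?_⟩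
  · intro b x
    obtain ⟨x, rfl⟩ := hq₁ x
    obtain ⟨b, rfl⟩ := MulOpposite.op_surjective b
    rw [S₁.actF_apply, hfF', hfF', S₂.actF_apply]
    congr 1
    induction x using TensorProduct.induction_on with
    | zero => simp
    | add x y hx hy => simp only [map_add, hx, hy]
    | tmul m r => simp
  · have e₁ : ∀ x, S₁.ofF (q₁.rTensor A' x) = S₁.toP (S₁.toV.rTensor A'
        ((TensorProduct.assoc k M₁ A A').symm (T.lTensorMul M₁ x))) :=
      LinearMap.congr_fun S₁.ofF_comp
    have e₂ : ∀ x, S₂.ofF (q₂.rTensor A' x) = S₂.toP (S₂.toV.rTensor A'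
        ((TensorProduct.assoc k M₂ A A').symm (T.lTensorMul M₂ x))) :=
      LinearMap.congr_fun S₂.ofF_comp
    have e₃ : ∀ x, T.lTensorMul M₂ ((f.rTensor R).rTensor A' x) =
        f.rTensor (A ⊗[k] A') (T.lTensorMul M₁ x) := LinearMap.congr_fun
      (f := T.lTensorMul M₂ ∘ₗ (f.rTensor R).rTensor A')
      (g := f.rTensor (A ⊗[k] A') ∘ₗ T.lTensorMul M₁) (by ext m r a'; simp)
    have e₄ : ∀ x, (TensorProduct.assoc k M₂ A A').symm (f.rTensor (A ⊗[k] A') x) =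
        (f.rTensor A).rTensor A' ((TensorProduct.assoc k M₁ A A').symm x) :=
      LinearMap.congr_fun
      (f := (TensorProduct.assoc k M₂ A A').symm.toLinearMap ∘ₗ f.rTensor (A ⊗[k] A'))
      (g := (f.rTensor A).rTensor A' ∘ₗ (TensorProduct.assoc k M₁ A A').symm.toLinearMap)
      (by ext m a a'; simp)
    refine LinearMap.ext fun y => ?_
    obtain ⟨x, rfl⟩ := LinearMap.rTensor_surjective A' hq₁ y
    rw [LinearMap.comp_apply, LinearMap.comp_apply, e₁, hfP', ← LinearMap.rTensor_comp_apply,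
      ← LinearMap.rTensor_comp_apply, hfF, hfV, LinearMap.rTensor_comp_apply,
      LinearMap.rTensor_comp_apply, e₂, e₃, e₄]

/-- `R` is faithfully flat over `D`. -/
lemma exact_iff (hA : IsFaithfullyFlatGalois k H A) (hA' : IsFaithfullyFlatGalois k H A')
    {σ₁ : Dᵐᵒᵖ →ₐ[k] Module.End k M₁} {q₁ : M₁ ⊗[k] R →ₗ[k] F₁}
    {σ₂ : Dᵐᵒᵖ →ₐ[k] Module.End k M₂} {q₂ : M₂ ⊗[k] R →ₗ[k] F₂}
    {σ₃ : Dᵐᵒᵖ →ₐ[k] Module.End k M₃} {q₃ : M₃ ⊗[k] R →ₗ[k] F₃}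
    (hq₁ : Presents (balRel σ₁ (leftAct T.base)) q₁)
    (hq₂ : Presents (balRel σ₂ (leftAct T.base)) q₂)
    (hq₃ : Presents (balRel σ₃ (leftAct T.base)) q₃)
    {f : M₁ →ₗ[k] M₂} (hf : ∀ d m, f (σ₁ d m) = σ₂ d (f m))
    {g : M₂ →ₗ[k] M₃} (hg : ∀ d m, g (σ₂ d m) = σ₃ d (g m))
    {fF : F₁ →ₗ[k] F₂} (hfF : fF ∘ₗ q₁ = q₂ ∘ₗ f.rTensor R)
    {gF : F₂ →ₗ[k] F₃} (hgF : gF ∘ₗ q₂ = q₃ ∘ₗ g.rTensor R) :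
    Function.Exact f g ↔ Function.Exact fF gF := by
  obtain ⟨V₁, P₁, _, _, _, _, ⟨S₁⟩⟩ := T.exists_tower hq₁
  obtain ⟨V₂, P₂, _, _, _, _, ⟨S₂⟩⟩ := T.exists_tower hq₂
  obtain ⟨V₃, P₃, _, _, _, _, ⟨S₃⟩⟩ := T.exists_tower hq₃
  obtain ⟨fV, fP, hfV, hfV', hfP, hfF', hfP'⟩ := S₁.exists_map S₂ hq₁.surjective hf hfF
  obtain ⟨gV, gP, hgV, hgV', hgP, hgF', hgP'⟩ := S₂.exists_map S₃ hq₂.surjective hg hgF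
  have ht : ∀ (b : coinvariants k H A) (a : A), leftAct (coinvariants k H A).val b a = b • a :=
    fun _ _ => rfl
  have ht' : ∀ (b : coinvariants k H A') (a : A'),
      leftAct (coinvariants k H A').val b a = b • a := fun _ _ => rfl
  -- Exactness of `f, g` goes up to the `V`'s by `A`, from there to the `P`'s by `A'`, and down to
  -- the `F`'s by `A'` again, the last step using that exactness is reflected.
  rw [hA.2.exact_iff ht (fun b m => hf _ m) (fun b m => hg _ m) S₁.presents_toV
      S₂.presents_toV S₃.presents_toV hfV hgV,
    hA'.2.exact_iff ht' hfV' hgV' S₁.presents_toP S₂.presents_toP S₃.presents_toP hfP hgP,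
    hA'.2.exact_iff ht' hfF' hgF' S₁.presents_ofF S₂.presents_ofF S₃.presents_ofF hfP' hgP']

end FaithfullyFlat

/-! ### Bijectivity of the canonical map of `R`. -/

section Galois

/-- The map `R ⊗ R → R ⊗ H`, `r ⊗ r' ↦ r r'₀ ⊗ r'₁`. -/
def canMap : R ⊗[k] R →ₗ[k] R ⊗[k] H :=
  LinearMap.mul' k (R ⊗[k] H) ∘ₗ
    TensorProduct.map (Algebra.TensorProduct.includeLeft (R := k) (S := k) (A := R)
      (B := H)).toLinearMap T.coact.toLinearMap

@[simp]
lemma canMap_tmul (r r' : R) : T.canMap (r ⊗ₜ r') = (r ⊗ₜ 1) * T.coact r' := rfl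

/-- The map `R ⊗ (A ⊗ A') → (A ⊗ A') ⊗ H`, `r ⊗ x ↦ r x₀ ⊗ x₁`, for the coaction of `A`. -/
def canLeft : R ⊗[k] (A ⊗[k] A') →ₗ[k] (A ⊗[k] A') ⊗[k] H :=
  LinearMap.mul' k ((A ⊗[k] A') ⊗[k] H) ∘ₗ
    TensorProduct.map ((Algebra.TensorProduct.includeLeft (R := k) (S := k) (A := A ⊗[k] A')
      (B := H)).comp T.incl).toLinearMap (coactLeft k H A A').toLinearMap

@[simp]
lemma canLeft_tmul (r : R) (x : A ⊗[k] A') :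
    T.canLeft (r ⊗ₜ x) = (T.incl r ⊗ₜ 1) * coactLeft k H A A' x := rfl

/-- `R ⊗_{B ⊗ B'} (A ⊗ A') ≅ (A ⊗ A') ⊗ H`. -/
lemma presents_canLeft (hA : IsFaithfullyFlatGalois k H A) :
    Presents (T.biRel (rightAct T.base)) T.canLeft := by
  let jA : A →ₐ[k] A ⊗[k] A' := Algebra.TensorProduct.includeLeft
  have h1 : Presents (balRel (rightAct (jA.comp (coinvariants k H A).val))
      (leftAct (coinvariants k H A).val)) (galoisMap H jA) := presents_galoisMap hA.1 jA
  have hcomm : ∀ b x, mulRightFactor T.incl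
      (((Module.End.rTensorAlgHom k R A').comp (rightAct (T.base.comp T.left))) b x) =
      rightAct (jA.comp (coinvariants k H A).val) b (mulRightFactor T.incl x) := by
    intro b x
    obtain ⟨b, rfl⟩ := MulOpposite.op_surjective b
    induction x using TensorProduct.induction_on with
    | zero => simp
    | add x y hx hy => simp only [map_add, hx, hy]
    | tmul r a' =>
      change T.incl (r * T.base (T.left b)) * (1 ⊗ₜ a') =
        T.incl r * (1 ⊗ₜ a') * ((b : A) ⊗ₜ 1)
      simp [mul_assoc]
  -- Here the balancing over `B'` comes first: `R ⊗_{B'} A' ≅ A ⊗ A'`, and then `(A ⊗ A') ⊗_B A ≅ (A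
  -- ⊗ A') ⊗ H`.
  have h2 := T.presents.iterate (fun b x => (hcomm b x).symm) h1
  let e : R ⊗[k] (A ⊗[k] A') ≃ₗ[k] (R ⊗[k] A') ⊗[k] A :=
    (TensorProduct.congr (LinearEquiv.refl k R) (TensorProduct.comm k A A')).trans
      (TensorProduct.assoc k R A' A).symm
  have h3 := h2.swap.conj e (T.biRel (rightAct T.base)) (by
    rintro (b | b)
    · ext r a a'
      simp [biRel, e]
      rfl
    · ext r a a'
      simp [biRel, e, TensorProduct.sub_tmul, right])
  convert h3 using 1
  ext r a a'
  have e1 : (1 : A) ⊗ₜ[k] a' * a ⊗ₜ[k] 1 = a ⊗ₜ a' := by simp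
  simp only [TensorProduct.AlgebraTensorModule.curry_apply, TensorProduct.curry_apply,
    LinearMap.restrictScalars_self, LinearMap.comp_apply]
  change (T.incl r ⊗ₜ 1) * coactLeft k H A A' (a ⊗ₜ a') =
    ((T.incl r * (1 ⊗ₜ a')) ⊗ₜ 1) * Algebra.TensorProduct.map jA (AlgHom.id k H)
      (coaction k H A a)
  rw [← coactLeft_tmul_one, ← e1, map_mul, coactLeft_one_tmul, ← mul_assoc,
    Algebra.TensorProduct.tmul_mul_tmul, mul_one]

/-- The map `(R ⊗ H) ⊗ A' → (A ⊗ A') ⊗ H`, `r ⊗ h ⊗ a' ↦ r (1 ⊗ a') ⊗ h`. -/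
def mulRightFactorH : (R ⊗[k] H) ⊗[k] A' →ₗ[k] (A ⊗[k] A') ⊗[k] H :=
  (mulRightFactor T.incl).rTensor H ∘ₗ (TensorProduct.rightComm k R H A').toLinearMap

lemma mulRightFactorH_tmul (t : R ⊗[k] H) (a' : A') : T.mulRightFactorH (t ⊗ₜ a') =
    Algebra.TensorProduct.map T.incl (AlgHom.id k H) t * ((1 ⊗ₜ a') ⊗ₜ 1) := by
  induction t using TensorProduct.induction_on with
  | zero => simp
  | add x y hx hy => simp only [TensorProduct.add_tmul, map_add, add_mul, hx, hy]
  | tmul r h => simp [mulRightFactorH]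

lemma presents_mulRightFactorH :
    Presents (balRel (rightAct ((Algebra.TensorProduct.includeLeft : R →ₐ[k] R ⊗[k] H).comp
      (T.base.comp T.right))) (leftAct (coinvariants k H A').val)) T.mulRightFactorH := by
  refine (T.presents.rTensor H).conj (TensorProduct.rightComm k R H A') _ (fun b => ?_)
  ext r h a'
  simp [TensorProduct.sub_tmul, right]

/-- The coaction of `R` is the restriction of `coactLeft`, under which `1 ⊗ a'` is invariant, so
multiplying by `1 ⊗ a'` before or after the coaction gives the same result. -/
lemma mulRightFactorH_comp_canMap :
    T.mulRightFactorH ∘ₗ T.canMap.rTensor A' = T.canLeft ∘ₗ T.lTensorMul R := by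
  ext r r' a'
  simp only [TensorProduct.AlgebraTensorModule.curry_apply, TensorProduct.curry_apply,
    LinearMap.restrictScalars_self, LinearMap.comp_apply, LinearMap.rTensor_tmul,
    canMap_tmul, mulRightFactorH_tmul, lTensorMul_tmul, canLeft_tmul, map_mul, T.map_coact,
    Algebra.TensorProduct.map_tmul, coactLeft_one_tmul, map_one, mul_assoc]

/-- `R` is Galois over `D`. -/
lemma presents_canMap (hA : IsFaithfullyFlatGalois k H A) (hA' : IsFaithfullyFlatGalois k H A') :
    Presents (balRel (rightAct T.base) (leftAct T.base)) T.canMap := by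
  have hq := Presents.mkQ (balRel (rightAct T.base) (leftAct T.base))
  obtain ⟨c, hc⟩ := hq.exists_lift T.canMap (fun d => by
    ext r r'
    simp [T.coact_base, ← mul_assoc])
  have hc' : ∀ x, c (Submodule.mkQ _ x) = T.canMap x := LinearMap.congr_fun hc
  obtain ⟨τ, w, hτ, hw, hw'⟩ := T.exists_presents hq (T.presents_canLeft hA)
  have ht' : ∀ (b : coinvariants k H A') (a : A'),
      leftAct (coinvariants k H A').val b a = b • a := fun _ _ => rfl
  have hbij : Function.Bijective c := by
    -- After `- ⊗_{B'} A'`, source and target are both modelled by `(A ⊗ A') ⊗ H`, and in these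
    -- models the canonical map is the identity.
    refine hA'.2.bijective ht' (s₁ := τ) ?_ hw' T.presents_mulRightFactorH
      (F := LinearMap.id) ?_ Function.bijective_id
    · intro b x
      obtain ⟨x, rfl⟩ := hq.surjective x
      obtain ⟨b, rfl⟩ := MulOpposite.op_surjective b
      rw [hτ, hc', hc']
      induction x using TensorProduct.induction_on with
      | zero => simp
      | add x y hx hy => simp only [map_add, hx, hy]
      | tmul r r' => simp [T.coact_base, mul_assoc]
    · refine LinearMap.ext fun y => ?_
      obtain ⟨x, rfl⟩ := LinearMap.rTensor_surjective A' hq.surjective y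
      have e1 := LinearMap.congr_fun hw x
      have e2 := LinearMap.congr_fun T.mulRightFactorH_comp_canMap x
      rw [← hc, LinearMap.rTensor_comp] at e2
      exact e1.trans e2.symm
  rw [← hc]
  exact hq.equiv_comp (LinearEquiv.ofBijective c hbij)

end Galois

end CotensorExtension

/-! ### The cotensor product. -/

section Cotensor

variable {k : Type v} {H A A' : Type u} [Field k] [Ring H] [HopfAlgebra k H]
  [Coalgebra.IsCocomm k H]
  [Ring A] [Algebra k A] [RightComoduleAlgebra k H A]
  [Ring A'] [Algebra k A'] [RightComoduleAlgebra k H A']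

/-- The cotensor product as an extension of its coinvariants. -/
def cotensorExtension (hA' : IsFaithfullyFlatGalois k H A') :
    CotensorExtension k H A A' (cotensor k H A A') (coinvariants k H (cotensor k H A A')) where
  incl := (cotensor k H A A').val
  coact := coaction k H (cotensor k H A A')
  base := (coinvariants k H (cotensor k H A A')).val
  coinv := toCoinvariantsCotensor k H A A'
  coinv_surjective := toCoinvariantsCotensor_bijective.2
  incl_base_coinv _ := rfl
  coact_base d := d.2
  map_coact r := (cotensorIncl_coaction r).trans r.2.symm
  presents := presents_mulRightFactor_cotensor hA'

lemma isFaithfullyFlatGalois_cotensor (hA : IsFaithfullyFlatGalois k H A)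
    (hA' : IsFaithfullyFlatGalois k H A') :
    IsFaithfullyFlatGalois k H (cotensor k H A A') := by
  constructor
  · have h := (cotensorExtension (A := A) hA').presents_canMap hA hA'
    have hs : ∀ b (m : cotensor k H A A'),
        rightAct (cotensorExtension (A := A) hA').base b m = b • m := fun _ _ => rfl
    have ht : ∀ b (m : cotensor k H A A'),
        leftAct (cotensorExtension (A := A) hA').base b m = b • m := fun _ _ => rfl
    have hq := presents_mkQ_balancedRelations _ _ hs ht
    constructor
    · rw [injective_iff_map_eq_zero]
      intro x hx
      obtain ⟨y, rfl⟩ := hq.surjective x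
      -- `canMap` and the quotient map onto the balanced tensor product have the same generating
      -- relations, hence the same kernel.
      have hy : y ∈ LinearMap.ker (cotensorExtension (A := A) hA').canMap := hx
      rw [h.ker_eq] at hy
      have hy' : y ∈ LinearMap.ker
          (balancedRelations k (coinvariants k H (cotensor k H A A')) _ _).mkQ := by
        rw [hq.ker_eq]
        exact hy
      exact hy'
    · intro z
      obtain ⟨y, rfl⟩ := h.surjective z
      exact ⟨Submodule.Quotient.mk y, rfl⟩
  · intro M₁ M₂ M₃ _ _ _ _ _ _ _ _ _ _ _ _ f g
    exact (cotensorExtension (A := A) hA').exact_iff hA hA'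
      (presents_mkQ_balancedRelations (Algebra.lsmul k k M₁) _ (fun _ _ => rfl) (fun _ _ => rfl))
      (presents_mkQ_balancedRelations (Algebra.lsmul k k M₂) _ (fun _ _ => rfl) (fun _ _ => rfl))
      (presents_mkQ_balancedRelations (Algebra.lsmul k k M₃) _ (fun _ _ => rfl) (fun _ _ => rfl))
      (f := f.restrictScalars k) (fun d m => f.map_smul d m)
      (g := g.restrictScalars k) (fun d m => g.map_smul d m) rfl rfl

end Cotensor

end HopfGalois

end

theorem theorem2p5 (k : Type v) (H A A' : Type u) [Field k] [Ring H] [HopfAlgebra k H]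
    [Coalgebra.IsCocomm k H]
    [Ring A] [Algebra k A] [HopfGalois.RightComoduleAlgebra k H A]
    [Ring A'] [Algebra k A'] [HopfGalois.RightComoduleAlgebra k H A']
    (hA : HopfGalois.IsFaithfullyFlatGalois k H A)
    (hA' : HopfGalois.IsFaithfullyFlatGalois k H A') :
    HopfGalois.IsFaithfullyFlatGalois k H (HopfGalois.cotensor k H A A') ∧
    ∃ e : (HopfGalois.coinvariants k H A ⊗[k] HopfGalois.coinvariants k H A') ≃ₐ[k]
        HopfGalois.coinvariants k H (HopfGalois.cotensor k H A A'),
      ∀ (b : HopfGalois.coinvariants k H A) (b' : HopfGalois.coinvariants k H A'),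
        ((e (b ⊗ₜ[k] b') : HopfGalois.cotensor k H A A') : A ⊗[k] A') =
          (b : A) ⊗ₜ[k] (b' : A') :=
  ⟨HopfGalois.isFaithfullyFlatGalois_cotensor hA hA',
    AlgEquiv.ofBijective (HopfGalois.toCoinvariantsCotensor k H A A')
      HopfGalois.toCoinvariantsCotensor_bijective, fun _ _ => rfl⟩
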